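/- **Setting.** Let $\mathbb D$ be the open unit disk, $\mathbb T$ the unit circle with normalized Lebesgue measure $m$, $L^p=L^p(\mathbb T,m)$, and $H^p\subseteq L^p$ ($1\le p\le\infty$) the Hardy space of functions whose Fourier coefficients of negative index vanish; for $f\in H^p$ and $w\in\mathbb D$ the value of its holomorphic extension is $f(w)=\int f\,\overline{k_w}\,dm$, where $k_w(\zeta)=(1-\overline w\zeta)^{-1}$. Let $\Gamma$ be a group of automorphisms $z\mapsto\lambda\frac{a-z}{1-\overline a z}$ ($|\lambda|=1$, $|a|<1$) of $\mathbb D$, acting also on $\mathbb T$. For a character $\sigma\in\hat\Gamma$, i.e. a homomorphism $\sigma:\Gamma\to\mathbb T$, let $L^p_\sigma=\{f\in L^p: f\circ\gamma=\sigma(\gamma)f\ \text{a.e. for all }\gamma\in\Gamma\}$ and $H^p_\sigma=H^p\cap L^p_\sigma$; write $L^p_\Gamma$, $H^p_\Gamma$ when $\sigma$ is trivial. Let $\Psi$ be the conditional expectation onto the $\sigma$-algebra of measurable sets $E\subseteq\mathbb T$ with $m(E\,\triangle\,\gamma^{-1}(E))=0$ for all $\gamma\in\Gamma$. The defect space of $\Gamma$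 is $N=\operatorname{span}\{v_\gamma:\gamma\in\Gamma\}$, where $v_\gamma=-i\,\Psi(k_{\gamma(0)}-\overline{k_{\gamma(0)}})$. The group $\Gamma$ is *admissible* if it is of convergence type, that is, $\sum_{\gamma\in\Gamma}(1-|\gamma(0)|)<\infty$ (so that $\Gamma$ is Fuchsian), and $N$ is finite-dimensional. **Theorem.** Let $\Gamma$ be admissible and let $f\in L^\infty_\Gamma$. Let $n\ge 0$ and $z_1,\dots,z_n\in\mathbb D$, let $\mathcal I$ be the ideal of functions in $H^\infty_\Gamma$ that vanish at $z_1,\dots,z_n$, and for $\sigma\in\hat\Gamma$ let $\mathcal N_\sigma=\{g\in H^2_\sigma: g(z_1)=\dots=g(z_n)=0\}$. Then $$\operatorname{dist}_{L^\infty}(f,\mathcal I)=\sup_{\sigma\in\hat\Gamma}\bigl\|(I-P_{\mathcal N_\sigma})M_fP_{H^2_\sigma}\bigr\|,$$ where $M_f$ is multiplication by $f$ on $L^2$, $I$ is the identity of $L^2$, $P_X$ is the orthogonal projection of $L^2$ onto a closed subspace $X$, and the norm is that of $B(L^2)$. In particular (no points), $$\operatorname{dist}_{L^\infty}(f,H^\infty_\Gamma)=\sup_{\sigma\in\hat\Gamma}\bigl\|(I-P_{H^2_\sigma})M_fP_{H^2_\sigma}\bigr\|.$$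 -/

import Mathlib

open MeasureTheory Filter Topology Set
open scoped ComplexConjugate ENNReal

noncomputable section

namespace FuchsianHardy

/-- The unit circle, in the parametrisation `t ↦ exp (2 π i t)`, `t ∈ ℝ / ℤ`. -/
abbrev T : Type := UnitAddCircle

/-- Normalised Lebesgue measure on the circle. -/
abbrev m : Measure T := AddCircle.haarAddCircle

/-- The point `exp (2 π i t)` of the unit circle in `ℂ`. -/
abbrev pt (t : T) : ℂ := (AddCircle.toCircle t : ℂ)

/-- The Möbius map `z ↦ c (a - z) / (1 - conj a z)`. -/
def mobius (c : Circle) (a z : ℂ) : ℂ := c * ((a - z) / (1 - conj a * z))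

theorem one_sub_ne {a z : ℂ} (ha : ‖a‖ < 1) (hz : ‖z‖ ≤ 1) : 1 - conj a * z ≠ 0 := by
  intro h
  have h1 : conj a * z = 1 := (sub_eq_zero.1 h).symm
  have h2 : ‖a‖ * ‖z‖ = 1 := by
    have := congrArg norm h1
    simpa using this
  nlinarith [norm_nonneg a, norm_nonneg z]

theorem norm_pt (t : T) : ‖pt t‖ = 1 := Circle.norm_coe _

theorem pt_injective : Function.Injective pt := fun _ _ h =>
  AddCircle.injective_toCircle one_ne_zero (Circle.coe_injective h)

theorem mobius_inv {c : Circle} {a z : ℂ} (ha : ‖a‖ < 1) (hz : ‖z‖ ≤ 1) :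
    mobius c⁻¹ (c * a) (mobius c a z) = z := by
  have h1 := one_sub_ne ha hz
  have hc : (c : ℂ) ≠ 0 := c.coe_ne_zero
  have hcc : conj (c : ℂ) = (c : ℂ)⁻¹ := by rw [← Circle.coe_inv, Circle.coe_inv_eq_conj]
  have h2 := one_sub_ne ha ha.le
  have h1' : 1 - z * conj a ≠ 0 := by rwa [mul_comm z]
  have h2' : 1 - a * conj a ≠ 0 := by rwa [mul_comm a]
  have h4 : 1 - conj ((c : ℂ) * a) * mobius c a z = (1 - conj a * a) / (1 - conj a * z) := by
    rw [mobius, map_mul, hcc]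
    field_simp
    ring
  have h5 : (c : ℂ) * a - mobius c a z = c * z * (1 - conj a * a) / (1 - conj a * z) := by
    rw [mobius]
    field_simp
    ring
  rw [mobius, h4, h5, Circle.coe_inv]
  field_simp

theorem exists_mobius_mobius (c d : Circle) (a b : Complex.UnitDisc) :
    ∃ (e : Circle) (w : Complex.UnitDisc), ∀ z : ℂ, ‖z‖ ≤ 1 →
      mobius c a (mobius d b z) = mobius e w z := by
  have ha := a.norm_lt_one
  have hb := b.norm_lt_one
  set A : ℂ := (a : ℂ) with hA
  set B : ℂ := (b : ℂ) with hB
  have hdd : conj (d : ℂ) * d = 1 := by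
    rw [mul_comm, Complex.mul_conj, Circle.normSq_coe]; simp
  have hd0 : (d : ℂ) ≠ 0 := d.coe_ne_zero
  have hdc : conj (d : ℂ) = (d : ℂ)⁻¹ := by rw [← Circle.coe_inv, Circle.coe_inv_eq_conj]
  -- `p` and `q` are the leading coefficients of numerator and denominator
  set p : ℂ := A * conj B - d with hp
  set q : ℂ := 1 - conj A * (d * B) with hq
  have hdB : ‖(d : ℂ) * B‖ ≤ 1 := by
    rw [norm_mul, Circle.norm_coe, one_mul]; exact hb.le
  have hq0 : q ≠ 0 := one_sub_ne ha hdB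
  have hpq : p = -d * conj q := by
    simp only [hp, hq, map_sub, map_one, map_mul, Complex.conj_conj, hdc]
    field_simp
    ring
  have hnpq : ‖p‖ = ‖q‖ := by rw [hpq, norm_mul, norm_neg, Circle.norm_coe, one_mul, RCLike.norm_conj]
  have hp0 : p ≠ 0 := by rw [← norm_ne_zero_iff, hnpq]; exact norm_ne_zero_iff.2 hq0
  set W : ℂ := (A - d * B) / p with hW
  have hWlt : ‖W‖ < 1 := by
    have key : Complex.normSq q - Complex.normSq (A - d * B)
        = (1 - Complex.normSq A) * (1 - Complex.normSq B) := by
      have : ((Complex.normSq q - Complex.normSq (A - d * B) : ℝ) : ℂ)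
          = ((1 - Complex.normSq A) * (1 - Complex.normSq B) : ℝ) := by
        push_cast
        simp only [← Complex.mul_conj, hq, map_sub, map_one, map_mul, Complex.conj_conj, hdc]
        field_simp
        ring
      exact_mod_cast this
    have hA2 : Complex.normSq A < 1 := a.normSq_lt_one
    have hB2 : Complex.normSq B < 1 := b.normSq_lt_one
    have h3 : Complex.normSq (A - d * B) < Complex.normSq q := by nlinarith
    rw [hW, norm_div, hnpq, div_lt_one (norm_pos_iff.2 hq0)]
    rw [Complex.normSq_eq_norm_sq, Complex.normSq_eq_norm_sq] at h3
    exact lt_of_pow_lt_pow_left₀ 2 (norm_nonneg _) h3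
  have hu : ‖p / q‖ = 1 := by rw [norm_div, hnpq, div_self (norm_ne_zero_iff.2 hq0)]
  obtain ⟨r, hr⟩ : ∃ r : Circle, (r : ℂ) = p / q := ⟨⟨p / q, mem_sphere_zero_iff_norm.2 hu⟩, rfl⟩
  refine ⟨c * r, .mk W hWlt, fun z hz => ?_⟩
  have h1 := one_sub_ne hb hz
  have h1' : 1 - z * conj B ≠ 0 := by rwa [mul_comm z]
  have hWc : conj W = (conj B - conj A * d) / q := by
    have : conj p = -(conj (d : ℂ)) * q := by rw [hpq]; simp
    rw [hW, map_div₀, this, hdc]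
    simp only [map_sub, map_mul, hdc]
    field_simp
    ring
  have e1 : A - mobius d B z = p * (W - z) / (1 - conj B * z) := by
    rw [hW, mobius]
    field_simp
    simp only [hp]
    ring
  have e2 : 1 - conj A * mobius d B z = q * (1 - conj W * z) / (1 - conj B * z) := by
    rw [hWc, mobius]
    field_simp
    simp only [hq]
    ring
  have h3 : 1 - conj W * z ≠ 0 := one_sub_ne hWlt hz
  have h3' : 1 - z * conj W ≠ 0 := by rwa [mul_comm z]
  rw [mobius, e1, e2, mobius, Complex.UnitDisc.coe_mk, Circle.coe_mul, hr]
  field_simp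

/-- The group of automorphisms of the unit disk. An element is the pair formed by a Möbius
transformation `z ↦ c (a - z) / (1 - conj a z)` of the open disk, `|c| = 1`, `|a| < 1`, and its
extension to the unit circle (given by the same formula). -/
def DiskAut : Subgroup (Equiv.Perm Complex.UnitDisc × Equiv.Perm T) where
  carrier := {φ | ∃ (c : Circle) (a : Complex.UnitDisc),
    (∀ z : Complex.UnitDisc, (φ.1 z : ℂ) = mobius c a z) ∧
      ∀ t : T, pt (φ.2 t) = mobius c a (pt t)}
  one_mem' := by
    refine ⟨-1, 0, fun z => ?_, fun t => ?_⟩ <;> simp [mobius]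
  mul_mem' := by
    rintro φ ψ ⟨c, a, h1, h2⟩ ⟨d, b, h3, h4⟩
    obtain ⟨e, w, h⟩ := exists_mobius_mobius c d a b
    refine ⟨e, w, fun z => ?_, fun t => ?_⟩
    · rw [← h _ z.norm_lt_one.le, ← h3, ← h1]; rfl
    · rw [← h _ (norm_pt t).le, ← h4, ← h2]; rfl
  inv_mem' := by
    rintro φ ⟨c, a, h1, h2⟩
    refine ⟨c⁻¹, c • a, fun z => ?_, fun t => ?_⟩
    · obtain ⟨y, rfl⟩ := φ.1.surjective z
      rw [h1, Complex.UnitDisc.coe_circle_smul, mobius_inv a.norm_lt_one y.norm_lt_one.le]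
      simp
    · obtain ⟨y, rfl⟩ := φ.2.surjective t
      rw [h2, Complex.UnitDisc.coe_circle_smul, mobius_inv a.norm_lt_one (norm_pt y).le]
      simp

/-- The action of an automorphism on the open disk. -/
def onDisk (γ : DiskAut) : Complex.UnitDisc → Complex.UnitDisc := γ.1.1

/-- The action of an automorphism on the circle. -/
def onCircle (γ : DiskAut) : T → T := γ.1.2

/-- A smooth lift to `ℝ` of the boundary map of an automorphism. -/
theorem exists_lift (γ : DiskAut) :
    ∃ k : ℝ → ℝ, Differentiable ℝ k ∧ ∀ x : ℝ, ((k x : ℝ) : T) = onCircle γ (x : T) := by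
  obtain ⟨c, a, -, h⟩ := γ.2
  have hpt : ∀ x : ℝ, pt (x : T) = Complex.exp (2 * Real.pi * Complex.I * x) := by
    intro x
    have := fourier_coe_apply (T := (1 : ℝ)) (n := 1) (x := x)
    rw [fourier_one] at this
    simpa [pt] using this
  have hre : ∀ x : ℝ, (1 - conj (a : ℂ) * pt (x : T)) ∈ Complex.slitPlane := by
    intro x
    left
    have h1 : ‖conj (a : ℂ) * pt (x : T)‖ < 1 := by
      rw [norm_mul, norm_pt, mul_one, RCLike.norm_conj]; exact a.norm_lt_one
    have h2 := (Complex.abs_re_le_norm (conj (a : ℂ) * pt (x : T))).trans_lt h1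
    rw [Complex.sub_re, Complex.one_re]
    linarith [(abs_lt.1 h2).2]
  refine ⟨fun x => Complex.arg (-c) / (2 * Real.pi) + x
    - (Complex.log (1 - conj (a : ℂ) * pt (x : T))).im / Real.pi, ?_, ?_⟩
  · have hd : Differentiable ℝ fun x : ℝ => Complex.log (1 - conj (a : ℂ) * pt (x : T)) := by
      intro x
      have h1 : DifferentiableAt ℝ (fun x : ℝ => 1 - conj (a : ℂ) * pt (x : T)) x := by
        simp only [hpt]
        have h2 : DifferentiableAt ℝ (fun x : ℝ => (x : ℂ)) x :=
          Complex.ofRealCLM.differentiableAt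
        fun_prop
      exact (h1.hasDerivAt.clog_real (hre x)).differentiableAt
    have him : Differentiable ℝ fun x : ℝ =>
        (Complex.log (1 - conj (a : ℂ) * pt (x : T))).im :=
      Complex.imCLM.differentiable.comp hd
    fun_prop
  · intro x
    apply pt_injective
    have hu0 := Complex.slitPlane_ne_zero (hre x)
    have hζ : pt (x : T) * conj (pt (x : T)) = 1 := by
      rw [Complex.mul_conj, Complex.normSq_eq_norm_sq, norm_pt]; simp
    have hpi : (Real.pi : ℂ) ≠ 0 := by exact_mod_cast Real.pi_ne_zero
    have hE : Complex.exp (Complex.arg (-c) * Complex.I) = -c := by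
      have := Complex.norm_mul_exp_arg_mul_I (-(c : ℂ))
      rwa [norm_neg, Circle.norm_coe, Complex.ofReal_one, one_mul] at this
    have hL : ∀ L : ℂ, conj L - L = -(2 * L.im * Complex.I) := by
      intro L
      apply Complex.ext <;> (simp; try ring)
    change pt _ = pt (γ.1.2 (x : T))
    rw [h, hpt]
    set u : ℂ := 1 - conj (a : ℂ) * pt (x : T) with hu
    have e1 : 2 * Real.pi * Complex.I * ((Complex.arg (-c) / (2 * Real.pi) + x
        - (Complex.log u).im / Real.pi : ℝ) : ℂ)
        = Complex.arg (-c) * Complex.I + 2 * Real.pi * Complex.I * x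
          + (conj (Complex.log u) - Complex.log u) := by
      rw [hL]
      push_cast
      field_simp
      ring
    rw [e1, Complex.exp_add, Complex.exp_add, hE, ← hpt, Complex.exp_sub, Complex.exp_conj,
      Complex.exp_log hu0, mobius, ← hu]
    have hcu : pt (x : T) * conj u = pt (x : T) - a := by
      rw [hu]
      simp only [map_sub, map_one, map_mul, Complex.conj_conj]
      linear_combination -(a : ℂ) * hζ
    linear_combination (-(c : ℂ) / u) * hcu

theorem measure_eq_zero_iff {S : Set T} (hS : MeasurableSet S) :
    m S = 0 ↔ volume ((fun x : ℝ => (x : T)) ⁻¹' S) = 0 := by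
  have hm : (m : Measure T) = volume := by
    rw [AddCircle.volume_eq_smul_haarAddCircle]; simp
  have hmk : Measurable (fun x : ℝ => (x : T)) := AddCircle.measurable_mk'
  have key : ∀ t : ℝ, m S = volume ((fun x : ℝ => (x : T)) ⁻¹' S ∩ Ioc t (t + 1)) := by
    intro t
    rw [hm, ← (UnitAddCircle.measurePreserving_mk t).measure_preimage hS.nullMeasurableSet,
      Measure.restrict_apply (hmk hS)]
  constructor
  · intro h0
    have hcov : (fun x : ℝ => (x : T)) ⁻¹' S
        ⊆ ⋃ n : ℤ, ((fun x : ℝ => (x : T)) ⁻¹' S ∩ Ioc (n : ℝ) (n + 1)) := by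
      intro x hx
      refine mem_iUnion.2 ⟨⌈x⌉ - 1, hx, ?_, ?_⟩
      · push_cast; linarith [Int.ceil_lt_add_one x]
      · push_cast; linarith [Int.le_ceil x]
    exact measure_mono_null hcov (measure_iUnion_null fun n => (key n).symm.trans h0)
  · intro h0
    rw [key 0]
    exact measure_mono_null inter_subset_left h0

theorem onCircle_inv (γ : DiskAut) (t : T) : onCircle γ⁻¹ (onCircle γ t) = t := by
  simp [onCircle]

theorem measurable_onCircle (γ : DiskAut) : Measurable (onCircle γ) := by
  obtain ⟨k, hk, h⟩ := exists_lift γ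
  have hc : Continuous (onCircle γ) := by
    refine (QuotientAddGroup.isOpenQuotientMap_mk
      (N := AddSubgroup.zmultiples (1 : ℝ))).isQuotientMap.continuous_iff.2 ?_
    have : (onCircle γ ∘ fun x : ℝ => (x : T)) = fun x => ((k x : ℝ) : T) := by
      funext x; exact (h x).symm
    change Continuous (onCircle γ ∘ fun x : ℝ => (x : T))
    rw [this]
    exact (AddCircle.continuous_mk' 1).comp hk.continuous
  exact hc.measurable

theorem quasiMeasurePreserving_onCircle (γ : DiskAut) :
    Measure.QuasiMeasurePreserving (onCircle γ) m m := by
  refine ⟨measurable_onCircle γ, Measure.AbsolutelyContinuous.mk fun S hS h0 => ?_⟩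
  have hS' := measurable_onCircle γ hS
  rw [Measure.map_apply (measurable_onCircle γ) hS, measure_eq_zero_iff hS']
  rw [measure_eq_zero_iff hS] at h0
  obtain ⟨k, hk, h⟩ := exists_lift γ⁻¹
  have h1 : volume (k '' ((fun x : ℝ => (x : T)) ⁻¹' S)) = 0 :=
    addHaar_image_eq_zero_of_differentiableOn_of_addHaar_eq_zero _ hk.differentiableOn h0
  have hcov : (fun x : ℝ => (x : T)) ⁻¹' (onCircle γ ⁻¹' S)
      ⊆ ⋃ n : ℤ, (fun x : ℝ => x + n) ⁻¹' (k '' ((fun x : ℝ => (x : T)) ⁻¹' S)) := by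
    intro x hx
    obtain ⟨y, hy⟩ := QuotientAddGroup.mk_surjective (onCircle γ (x : T))
    have hy' : (y : T) = onCircle γ (x : T) := hy
    have h2 : ((k y : ℝ) : T) = (x : T) := by rw [h, hy', onCircle_inv]
    have h3 : ((k y - x : ℝ) : T) = 0 := by
      rw [AddCircle.coe_sub, h2, sub_self]
    obtain ⟨n, hn⟩ := (AddCircle.coe_eq_zero_iff 1).1 h3
    refine mem_iUnion.2 ⟨n, y, ?_, ?_⟩
    · change (y : T) ∈ S
      rw [hy']; exact hx
    · simp at hn
      change k y = x + n
      linarith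
  refine measure_mono_null hcov (measure_iUnion_null fun n => ?_)
  rw [measure_preimage_add_right, h1]

/-- `L^p` of the circle. -/
abbrev L (p : ℝ≥0∞) : Type := Lp ℂ p m

/-- The space `L^p_σ` of those `f ∈ L^p` with `f ∘ γ = σ(γ) f` almost everywhere, for all
`γ ∈ Γ`. For the trivial character `σ = 1` this is the space `L^p_Γ` of `Γ`-invariant functions. -/
def charL (p : ℝ≥0∞) (Γ : Subgroup DiskAut) (σ : Γ →* Circle) : Submodule ℂ (L p) where
  carrier := {f | ∀ γ : Γ, (fun t => f (onCircle γ t)) =ᵐ[m] fun t => (σ γ : ℂ) * f t}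
  zero_mem' := by
    intro γ
    have h := Lp.coeFn_zero ℂ p m
    filter_upwards [h, (quasiMeasurePreserving_onCircle γ).ae h] with t h1 h2
    rw [h1, h2]; simp
  add_mem' := by
    intro f g hf hg γ
    have h := Lp.coeFn_add f g
    filter_upwards [h, (quasiMeasurePreserving_onCircle γ).ae h, hf γ, hg γ] with t h1 h2 h3 h4
    rw [h1, h2, Pi.add_apply, Pi.add_apply, h3, h4, mul_add]
  smul_mem' := by
    intro c f hf γ
    have h := Lp.coeFn_smul c f
    filter_upwards [h, (quasiMeasurePreserving_onCircle γ).ae h, hf γ] with t h1 h2 h3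
    rw [h1, h2, Pi.smul_apply, Pi.smul_apply, h3, smul_eq_mul, smul_eq_mul]; ring

theorem integrable_coe {p : ℝ≥0∞} [hp : Fact (1 ≤ p)] (f : L p) : Integrable f m :=
  (Lp.memLp f).integrable hp.out

/-- The Hardy space `H^p`: the functions in `L^p` whose Fourier coefficients of negative index
vanish. -/
def hardy (p : ℝ≥0∞) [Fact (1 ≤ p)] : Submodule ℂ (L p) where
  carrier := {f | ∀ n : ℤ, n < 0 → fourierCoeff f n = 0}
  zero_mem' := by
    intro n _
    rw [fourierCoeff_congr_ae (Lp.coeFn_zero ℂ p m)]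
    simp [fourierCoeff]
  add_mem' := by
    intro f g hf hg n hn
    rw [fourierCoeff_congr_ae (Lp.coeFn_add f g), fourierCoeff.add (integrable_coe f)
      (integrable_coe g), Pi.add_apply, hf n hn, hg n hn, add_zero]
  smul_mem' := by
    intro c f hf n hn
    rw [fourierCoeff_congr_ae (Lp.coeFn_smul c f), fourierCoeff.const_smul, hf n hn, smul_zero]

/-- The boundary function of the Szegő kernel `k_w(z) = 1 / (1 - conj w z)` at `w`, `|w| < 1`. -/
def szego (w : Complex.UnitDisc) : C(T, ℂ) where
  toFun t := 1 / (1 - conj (w : ℂ) * pt t)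
  continuous_toFun := by
    refine continuous_const.div ?_ fun t => one_sub_ne w.norm_lt_one (norm_pt t).le
    exact continuous_const.sub (continuous_const.mul
      (continuous_subtype_val.comp AddCircle.continuous_toCircle))

/-- The value at `w`, `|w| < 1`, of the holomorphic extension to the disk of `f ∈ H^p`, given by
Cauchy's formula `f(w) = ∫ f conj(k_w) dm`. -/
def value (w : Complex.UnitDisc) (f : T → ℂ) : ℂ := ∫ t, f t * conj (szego w t) ∂m

theorem integrable_mul_szego {p : ℝ≥0∞} [Fact (1 ≤ p)] (w : Complex.UnitDisc) (f : L p) :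
    Integrable (fun t => f t * conj (szego w t)) m :=
  (integrable_coe f).mul_bdd (c := ‖szego w‖)
    ((Complex.continuous_conj.comp (szego w).continuous).aestronglyMeasurable)
    (.of_forall fun t => by
      rw [RCLike.norm_conj]; exact (szego w).norm_coe_le_norm t)

/-- The functions in `L^p` whose value at each `z j` (as defined above) is zero; to be
intersected with Hardy spaces. -/
def vanishing (p : ℝ≥0∞) [Fact (1 ≤ p)] {n : ℕ} (z : Fin n → Complex.UnitDisc) :
    Submodule ℂ (L p) where
  carrier := {f | ∀ j, value (z j) f = 0}
  zero_mem' := by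
    intro j
    rw [value, integral_congr_ae (g := fun _ => (0 : ℂ)), integral_zero]
    filter_upwards [Lp.coeFn_zero ℂ p m] with t h
    rw [h]; simp
  add_mem' := by
    intro f g hf hg j
    rw [value, integral_congr_ae (g := fun t => f t * conj (szego (z j) t)
      + g t * conj (szego (z j) t)), integral_add (integrable_mul_szego _ f)
      (integrable_mul_szego _ g)]
    · have h1 := hf j
      have h2 := hg j
      rw [value] at h1 h2
      rw [h1, h2, add_zero]
    · filter_upwards [Lp.coeFn_add f g] with t h
      rw [h, Pi.add_apply, add_mul]
  smul_mem' := by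
    intro c f hf j
    rw [value, integral_congr_ae (g := fun t => c * (f t * conj (szego (z j) t))),
      integral_const_mul]
    · have h1 := hf j
      rw [value] at h1
      rw [h1, mul_zero]
    · filter_upwards [Lp.coeFn_smul c f] with t h
      rw [h, Pi.smul_apply, smul_eq_mul, mul_assoc]

/-- The character-automorphic Hardy space `H^p_σ`; for `σ = 1` it is `H^p_Γ`. -/
def charHardy (p : ℝ≥0∞) [Fact (1 ≤ p)] (Γ : Subgroup DiskAut) (σ : Γ →* Circle) :
    Submodule ℂ (L p) :=
  hardy p ⊓ charL p Γ σ

/-- The functions in `H^p_σ` that vanish at the points `z j` of the disk. For `p = ∞`, `σ = 1` this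
is the ideal of `H^∞_Γ` determined by the points; for `p = 2` it is the space `N_σ`. -/
def charHardyVanishing (p : ℝ≥0∞) [Fact (1 ≤ p)] (Γ : Subgroup DiskAut) (σ : Γ →* Circle) {n : ℕ}
    (z : Fin n → Complex.UnitDisc) : Submodule ℂ (L p) :=
  charHardy p Γ σ ⊓ vanishing p z

/-- The sigma-algebra of `Γ`-invariant sets: measurable `E` such that `γ⁻¹(E)` and `E` differ by a
null set for all `γ ∈ Γ`. -/
@[reducible]
def invariantSets (Γ : Subgroup DiskAut) : MeasurableSpace T where
  MeasurableSet' E := MeasurableSet E ∧ ∀ γ : Γ, (onCircle γ ⁻¹' E : Set T) =ᵐ[m] E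
  measurableSet_empty := ⟨.empty, fun γ => by
    rw [preimage_empty]; exact .rfl⟩
  measurableSet_compl E hE := ⟨hE.1.compl, fun γ => by
    rw [preimage_compl]; exact (hE.2 γ).compl⟩
  measurableSet_iUnion E hE := ⟨.iUnion fun n => (hE n).1, fun γ => by
    rw [preimage_iUnion]; exact Filter.EventuallyEq.countable_iUnion fun n => (hE n).2 γ⟩

theorem invariantSets_le (Γ : Subgroup DiskAut) :
    invariantSets Γ ≤ (inferInstance : MeasurableSpace T) := fun _ hE => hE.1

/-- The conditional expectation `Ψ` onto `L^2_Γ`, that is, onto the functions in `L^2` which are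
measurable for the sigma-algebra of `Γ`-invariant sets. -/
def Psi (Γ : Subgroup DiskAut) (f : L 2) : L 2 :=
  condExpL2 ℂ ℂ (invariantSets_le Γ) f

/-- `v_γ = -i Ψ(k_{γ(0)} - conj k_{γ(0)})`. -/
def defectVector (Γ : Subgroup DiskAut) (γ : Γ) : L 2 :=
  (-Complex.I) • Psi Γ (ContinuousMap.toLp (E := ℂ) 2 m ℂ
    (szego (onDisk γ 0) - star (szego (onDisk γ 0))))

/-- Forelli's defect space: the linear span of the `v_γ`, `γ ∈ Γ`. -/
def defectSpace (Γ : Subgroup DiskAut) : Submodule ℂ (L 2) :=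
  Submodule.span ℂ (range (defectVector Γ))

/-- `Γ` is of convergence type: `∑_{γ ∈ Γ} (1 - |γ(0)|) < ∞`. -/
def ConvergenceType (Γ : Subgroup DiskAut) : Prop :=
  Summable fun γ : Γ => 1 - ‖(onDisk γ 0 : ℂ)‖

/-- `Γ` is admissible: it is of convergence type (in particular discrete, i.e. Fuchsian) and its
defect space is finite dimensional. -/
structure Admissible (Γ : Subgroup DiskAut) : Prop where
  convergenceType : ConvergenceType Γ
  finiteDimensional_defectSpace : FiniteDimensional ℂ (defectSpace Γ)

/-- Multiplication by `f ∈ L^∞` as a bounded operator on `L^2`. -/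
def mulOp (f : L ∞) : L 2 →L[ℂ] L 2 := (ContinuousLinearMap.mul ℂ ℂ).holderL m ∞ 2 2 f

/-! The spaces involved are closed, so that the orthogonal projections onto them exist. -/

theorem isClosed_charL (Γ : Subgroup DiskAut) (σ : Γ →* Circle) :
    IsClosed (charL 2 Γ σ : Set (L 2)) := by
  refine IsSeqClosed.isClosed fun f g hf hfg => ?_
  obtain ⟨ns, -, hns⟩ := (tendstoInMeasure_of_tendsto_Lp hfg).exists_seq_tendsto_ae
  intro γ
  have h1 : ∀ᵐ t ∂m, ∀ i, f (ns i) (onCircle γ t) = (σ γ : ℂ) * f (ns i) t :=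
    ae_all_iff.2 fun i => hf (ns i) γ
  filter_upwards [hns, (quasiMeasurePreserving_onCircle γ).ae hns, h1] with t h2 h3 h4
  refine tendsto_nhds_unique h3 ?_
  simp only [h4]
  exact h2.const_mul _

theorem isClosed_hardy : IsClosed (hardy 2 : Set (L 2)) := by
  have : (hardy 2 : Set (L 2)) = ⋂ n : ℤ, ⋂ _ : n < 0,
      {f : L 2 | inner ℂ (fourierLp (T := (1 : ℝ)) 2 n) f = 0} := by
    ext f
    simp only [mem_iInter, mem_ofPred_eq]
    refine forall_congr' fun n => forall_congr' fun _ => ?_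
    rw [← coe_fourierBasis, ← HilbertBasis.repr_apply_apply, fourierBasis_repr]
  rw [this]
  exact isClosed_iInter fun n => isClosed_iInter fun _ =>
    isClosed_eq (continuous_const.inner continuous_id) continuous_const

theorem isClosed_vanishing {n : ℕ} (z : Fin n → Complex.UnitDisc) :
    IsClosed (vanishing 2 z : Set (L 2)) := by
  have : (vanishing 2 z : Set (L 2)) = ⋂ j : Fin n,
      {f : L 2 | inner ℂ (ContinuousMap.toLp (E := ℂ) 2 m ℂ (szego (z j))) f = 0} := by
    ext f
    simp only [mem_iInter, mem_ofPred_eq]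
    refine forall_congr' fun j => ?_
    rw [L2.inner_def, value]
    refine Eq.congr (integral_congr_ae ?_) rfl
    filter_upwards [ContinuousMap.coeFn_toLp (p := 2) (𝕜 := ℂ) m (szego (z j))] with t h
    rw [h, RCLike.inner_apply]
  rw [this]
  exact isClosed_iInter fun j =>
    isClosed_eq (continuous_const.inner continuous_id) continuous_const

instance completeSpace_charHardy (Γ : Subgroup DiskAut) (σ : Γ →* Circle) :
    CompleteSpace (charHardy 2 Γ σ) :=
  (isClosed_hardy.inter (isClosed_charL Γ σ)).completeSpace_coe

instance completeSpace_charHardyVanishing (Γ : Subgroup DiskAut) (σ : Γ →* Circle) {n : ℕ}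
    (z : Fin n → Complex.UnitDisc) : CompleteSpace (charHardyVanishing 2 Γ σ z) :=
  ((isClosed_hardy.inter (isClosed_charL Γ σ)).inter (isClosed_vanishing z)).completeSpace_coe

end FuchsianHardy

end

/-! Lower bound for the distance: an element φ of the ideal multiplies $H^2_\sigma$ into $\mathcal
N_\sigma$, so replacing $f$ by $f-φ$ does not change the operator, whose norm is therefore at most
$\|f-φ\|_\infty$ (`norm_le_dist`).

Upper bound: let C bound all the operator norms and let w be a Γ-invariant weight, bounded above and
away from zero. By Szegő's theorem (`exists_outer`) $w=|h|^2$ with h and 1/h bounded analytic. Since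
$|h|$ is invariant, $h∘γ/h$ is unimodular and analytic together with its inverse, hence constant;
these constants form a character σ (`Weight.exists_outer`). So h lies in $H^2_\sigma$. Testing the
operator for this σ on h and dividing the projection of $fh$ by h gives φ in $\mathcal N_1$ with
$\int|f-φ|^2w\le C^2\int w$ (`exists_weighted_approx`).

This φ depends on w. The `excess` $\int(|f-φ|^2-C^2)w$ is convex and continuous in φ and linear in
w, and positive combinations of weights are weights. A minimax principle in the Hilbert space $L^2$
(`exists_forall_nonpos_of_mixtures`) therefore yields one φ good for all w. Weights concentrated on
the invariant set where $|f-φ|>C$ show that this set is null (`norm_sub_le_of_excess_nonpos`). Thus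
φ is bounded, lies in the ideal, and is within C of f. -/

noncomputable section

namespace FuchsianHardy

/-! ### A minimax principle in Hilbert space -/

section Minimax

variable {H : Type*} [NormedAddCommGroup H] [InnerProductSpace ℝ H] {ι : Type*}

/-- A family of closed convex sets in a Hilbert space, one of which is bounded, has a common point
as soon as every finite subfamily has one. -/
theorem iInter_nonempty_of_closed_convex [CompleteSpace H] (K : ι → Set H)
    (hcl : ∀ i, IsClosed (K i)) (hcv : ∀ i, Convex ℝ (K i)) (i₀ : ι)
    (hb : Bornology.IsBounded (K i₀))
    (hfin : ∀ s : Finset ι, (⋂ i ∈ s, K i).Nonempty) : (⋂ i, K i).Nonempty := by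
  classical
  let Q : Finset ι → Set H := fun s => ⋂ i ∈ s, K i
  have hQcl : ∀ s, IsClosed (Q s) := fun s => isClosed_biInter fun i _ => hcl i
  have hQcv : ∀ s, Convex ℝ (Q s) := fun s => convex_iInter₂ fun i _ => hcv i
  -- Completeness replaces weak compactness: the points of least norm of the finite intersections
  -- form a Cauchy net, and its limit is the common point.
  have hmin : ∀ s, ∃ v ∈ Q s, ∀ w ∈ Q s, ‖v‖ ≤ ‖w‖ := by
    intro s
    obtain ⟨v, hv, h⟩ := exists_norm_eq_iInf_of_complete_convex (hfin s)
      (hQcl s).isComplete (hQcv s) 0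
    refine ⟨v, hv, fun w hw => ?_⟩
    have h1 : (⨅ w : Q s, ‖(0 : H) - w‖) ≤ ‖(0 : H) - (⟨w, hw⟩ : Q s)‖ :=
      ciInf_le ⟨0, by rintro _ ⟨y, rfl⟩; positivity⟩ _
    simpa using h.le.trans h1
  choose x hx hxmin using hmin
  have hQanti : ∀ {s t : Finset ι}, s ⊆ t → Q t ⊆ Q s := fun hst =>
    biInter_subset_biInter_left hst
  have hmono : Monotone fun s => ‖x s‖ := fun s t hst => hxmin s _ (hQanti hst (hx t))
  -- The midpoint of `x s` and `x t` lies in `Q s`, so its norm is at least `‖x s‖`; the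
  -- parallelogram law does the rest.
  have hdist : ∀ {s t : Finset ι}, s ⊆ t → ‖x s - x t‖ ^ 2 ≤ 2 * (‖x t‖ ^ 2 - ‖x s‖ ^ 2) := by
    intro s t hst
    have hm : (2⁻¹ : ℝ) • x s + (2⁻¹ : ℝ) • x t ∈ Q s :=
      hQcv s (hx s) (hQanti hst (hx t)) (by norm_num) (by norm_num) (by norm_num)
    have h1 := hxmin s _ hm
    rw [← smul_add, norm_smul] at h1
    norm_num at h1
    have h2 := parallelogram_law_with_norm ℝ (x s) (x t)
    nlinarith [norm_nonneg (x s), norm_nonneg (x s + x t)]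
  obtain ⟨R, hR⟩ := hb.exists_norm_le
  have hbdd : BddAbove (range fun s => ‖x s‖ ^ 2) := by
    refine ⟨R ^ 2, ?_⟩
    rintro _ ⟨s, rfl⟩
    have h1 : ‖x s‖ ≤ ‖x (insert i₀ s)‖ := hmono (Finset.subset_insert _ _)
    have h2 : ‖x (insert i₀ s)‖ ≤ R :=
      hR _ (mem_iInter₂.1 (hx (insert i₀ s)) i₀ (Finset.mem_insert_self _ _))
    exact pow_le_pow_left₀ (norm_nonneg _) (h1.trans h2) 2
  have hcau : CauchySeq x := by
    rw [Metric.cauchySeq_iff']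
    intro ε hε
    have hlt : (⨆ s, ‖x s‖ ^ 2) - ε ^ 2 / 2 < ⨆ s, ‖x s‖ ^ 2 := by
      have : 0 < ε ^ 2 / 2 := by positivity
      linarith
    obtain ⟨s, hs⟩ := exists_lt_of_lt_ciSup hlt
    refine ⟨s, fun t hst => ?_⟩
    have h1 := hdist hst
    have h2 := le_ciSup hbdd t
    rw [dist_comm, dist_eq_norm]
    refine lt_of_pow_lt_pow_left₀ 2 hε.le ?_
    linarith
  obtain ⟨a, ha⟩ := cauchySeq_tendsto_of_complete hcau
  refine ⟨a, mem_iInter.2 fun i => (hcl i).mem_of_tendsto ha ?_⟩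
  filter_upwards [eventually_ge_atTop {i}] with s hs
  exact mem_iInter₂.1 (hx s) i (hs (Finset.mem_singleton_self i))

/-- The finite-dimensional separation step of the minimax principle. -/
theorem exists_forall_lt_of_mixtures {S : Set H} (hS : Convex ℝ S) (hSne : S.Nonempty)
    (F : ι → H → ℝ) (hF : ∀ i, ConvexOn ℝ univ (F i))
    (hmix : ∀ (s : Finset ι) (c : ι → ℝ), (∀ i, 0 ≤ c i) → 0 < ∑ i ∈ s, c i →
      ∃ x ∈ S, ∑ i ∈ s, c i * F i x ≤ 0)
    (s : Finset ι) {ε : ℝ} (hε : 0 < ε) : ∃ x ∈ S, ∀ i ∈ s, F i x < ε := by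
  classical
  -- The vectors that strictly dominate some value of `F` on `S` form an open convex set. If the
  -- constant vector `ε` is not among them, it is separated from them by a linear functional, whose
  -- coefficients are the weights of a forbidden mixture.
  let t : Set (s → ℝ) := {y | ∃ x ∈ S, ∀ i : s, F i x < y i}
  have ht1 : Convex ℝ t := by
    rintro y ⟨x, hx, hy⟩ y' ⟨x', hx', hy'⟩ a b ha hb hab
    refine ⟨a • x + b • x', hS hx hx' ha hb hab, fun i => ?_⟩
    refine ((hF i).2 (mem_univ x) (mem_univ x') ha hb hab).trans_lt ?_
    simp only [Pi.add_apply, Pi.smul_apply, smul_eq_mul]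
    rcases ha.eq_or_lt with rfl | ha
    · have : b = 1 := by linarith
      subst this
      simpa using hy' i
    · nlinarith [mul_lt_mul_of_pos_left (hy i) ha, mul_le_mul_of_nonneg_left (hy' i).le hb]
  have ht2 : IsOpen t := by
    have : t = ⋃ x ∈ S, ⋂ i : s, {y : s → ℝ | F i x < y i} := by
      ext y; simp [t]
    rw [this]
    exact isOpen_biUnion fun x _ => isOpen_iInter_of_finite fun i =>
      isOpen_lt continuous_const (continuous_apply i)
  by_contra hcon
  have hnot : (fun _ : s => ε) ∉ t := by
    rintro ⟨x, hx, h⟩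
    exact hcon ⟨x, hx, fun i hi => h ⟨i, hi⟩⟩
  obtain ⟨f, hf⟩ := geometric_hahn_banach_point_open ht1 ht2 hnot
  let c : s → ℝ := fun i => f (Pi.single i 1)
  have hfc : ∀ y : s → ℝ, f y = ∑ i, c i * y i := by
    intro y
    conv_lhs => rw [pi_eq_sum_univ' y]
    rw [map_sum]
    refine Finset.sum_congr rfl fun i _ => ?_
    rw [map_smul, smul_eq_mul, mul_comm]
  obtain ⟨x₀, hx₀⟩ := hSne
  have hmem : ∀ x ∈ S, ∀ z : s → ℝ, (∀ i, 0 < z i) → (fun i : s => F i x + z i) ∈ t :=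
    fun x hx z hz => ⟨x, hx, fun i => by linarith [hz i]⟩
  -- `t` is closed under increasing coordinates. If `c i` were negative, raising coordinate `i` by
  -- `A / -c i` would lower `f` by exactly the gap `A`, against strict separation.
  have hc : ∀ i, 0 ≤ c i := by
    intro i
    by_contra! hneg
    let A : ℝ := f (fun j : s => F j x₀ + 1) - f (fun _ => ε)
    have hA : 0 < A := sub_pos.2 (hf _ (hmem x₀ hx₀ _ fun _ => one_pos))
    have h1 := hf _ (hmem x₀ hx₀ ((fun _ => 1) + (A / -c i) • Pi.single i 1) (fun j => by
      have h0 : 0 ≤ A / -c i := by apply div_nonneg hA.le; linarith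
      have h2 : (0 : ℝ) ≤ (Pi.single i 1 : s → ℝ) j := by
        rw [Pi.single_apply]; split_ifs <;> norm_num
      have h3 := mul_nonneg h0 h2
      simp only [Pi.add_apply, Pi.smul_apply, smul_eq_mul]
      linarith))
    have h2 : (fun j : s => F j x₀ + ((fun _ => 1) + (A / -c i) • Pi.single i 1 : s → ℝ) j)
        = (fun j : s => F j x₀ + 1) + (A / -c i) • Pi.single i 1 := by
      funext j; simp [add_assoc]
    rw [h2, map_add, map_smul, smul_eq_mul] at h1
    have h3 : A / -c i * f (Pi.single i 1) = -A := by
      change A / -c i * c i = -A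
      rw [div_neg, neg_mul, div_mul_cancel₀ _ hneg.ne]
    rw [h3] at h1
    simp only [A] at h1
    linarith
  have hkey : ∀ x ∈ S, ε * ∑ i, c i ≤ ∑ i, c i * F i x := by
    intro x hx
    refine le_of_forall_pos_le_add fun δ hδ => ?_
    have hpos : 0 < ∑ i, c i + 1 := by
      have := Finset.sum_nonneg fun i (_ : i ∈ Finset.univ) => hc i
      linarith
    have h1 := hf _ (hmem x hx (fun _ => δ / (∑ i, c i + 1)) fun _ => div_pos hδ hpos)
    rw [hfc, hfc] at h1
    simp only [mul_add, Finset.sum_add_distrib, ← Finset.sum_mul] at h1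
    have h2 : (∑ i, c i) * (δ / (∑ i, c i + 1)) ≤ δ := by
      rw [mul_div_assoc', div_le_iff₀ hpos]
      nlinarith
    linarith
  -- With all coefficients zero, strict separation would read 0 < 0.
  have hsum : 0 < ∑ i, c i := by
    refine lt_of_le_of_ne (Finset.sum_nonneg fun i _ => hc i) fun h0 => ?_
    have hz : ∀ i, c i = 0 := fun i =>
      (Finset.sum_eq_zero_iff_of_nonneg fun i _ => hc i).1 h0.symm i (Finset.mem_univ i)
    have h1 := hf _ (hmem x₀ hx₀ _ fun _ => one_pos)
    rw [hfc, hfc] at h1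
    simp [hz] at h1
  let c' : ι → ℝ := fun i => if h : i ∈ s then c ⟨i, h⟩ else 0
  have hsum' : ∀ g : ι → ℝ, ∑ i ∈ s, c' i * g i = ∑ i : s, c i * g i := by
    intro g
    rw [← Finset.sum_coe_sort]
    refine Finset.sum_congr rfl fun i _ => ?_
    simp [c']
  obtain ⟨x, hx, hle⟩ := hmix s c' (fun i => by
    simp only [c']; split_ifs; exacts [hc _, le_rfl]) (by
    have := hsum' fun _ => 1
    simp only [mul_one] at this
    rwa [this])
  rw [hsum'] at hle
  have := hkey x hx
  nlinarith [mul_pos hε hsum]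

/-- A minimax principle: if convex continuous functions `F i` on a closed convex set `S`, one of
them with bounded sublevel sets, are such that each of their positive combinations takes a
nonpositive value on `S`, then they are all nonpositive at one common point of `S`. -/
theorem exists_forall_nonpos_of_mixtures [CompleteSpace H] {S : Set H} (hS : Convex ℝ S)
    (hScl : IsClosed S) (hSne : S.Nonempty) (F : ι → H → ℝ) (hF : ∀ i, ConvexOn ℝ univ (F i))
    (hFc : ∀ i, Continuous (F i)) (i₀ : ι) (hb : ∀ R, Bornology.IsBounded {x | F i₀ x ≤ R})
    (hmix : ∀ (s : Finset ι) (c : ι → ℝ), (∀ i, 0 ≤ c i) → 0 < ∑ i ∈ s, c i →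
      ∃ x ∈ S, ∑ i ∈ s, c i * F i x ≤ 0) :
    ∃ x ∈ S, ∀ i, F i x ≤ 0 := by
  classical
  -- The separation argument reaches only positive levels, so level 0 is approached through the
  -- levels 1/(n+1).
  let K : ι × ℕ → Set H := fun p => S ∩ {x | F p.1 x ≤ 1 / ((p.2 : ℝ) + 1)}
  obtain ⟨x, hx⟩ := iInter_nonempty_of_closed_convex K
    (fun p => hScl.inter (isClosed_le (hFc p.1) continuous_const))
    (fun p => hS.inter (by simpa using (hF p.1).convex_le (1 / ((p.2 : ℝ) + 1)))) (i₀, 0)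
    ((hb _).subset inter_subset_right) (by
      intro s
      have hε : (0 : ℝ) < 1 / ((s.sup Prod.snd : ℕ) + 1) := by positivity
      obtain ⟨x, hx, h⟩ := exists_forall_lt_of_mixtures hS hSne F hF hmix (s.image Prod.fst) hε
      refine ⟨x, mem_iInter₂.2 fun p hp => ⟨hx, (h p.1 (Finset.mem_image_of_mem _ hp)).le.trans ?_⟩⟩
      have : p.2 ≤ s.sup Prod.snd := Finset.le_sup (f := Prod.snd) hp
      have : (p.2 : ℝ) ≤ (s.sup Prod.snd : ℕ) := by exact_mod_cast this
      gcongr)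
  rw [mem_iInter] at hx
  refine ⟨x, (hx (i₀, 0)).1, fun i => ?_⟩
  exact ge_of_tendsto' tendsto_one_div_add_atTop_nhds_zero_nat fun n => (hx (i, n)).2

end Minimax

/-! ### Analytic functions on the circle -/

/-- A function on the circle is analytic if it is square integrable and its Fourier coefficients of
negative index vanish. -/
structure Analytic (f : T → ℂ) : Prop where
  memLp : MemLp f 2 m
  coeff : ∀ n : ℤ, n < 0 → fourierCoeff f n = 0

theorem pt_eq_fourier (t : T) : pt t = fourier 1 t := fourier_one.symm

theorem norm_fourier_apply (n : ℤ) (t : T) : ‖fourier n t‖ = 1 := by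
  rw [fourier_apply, Circle.norm_coe]

theorem memLp_continuous {p : ℝ≥0∞} (f : C(T, ℂ)) : MemLp f p m :=
  (memLp_top_of_bound f.continuous.aestronglyMeasurable ‖f‖
    (.of_forall f.norm_coe_le_norm)).mono_exponent le_top

theorem Analytic.congr {f g : T → ℂ} (hf : Analytic f) (h : f =ᵐ[m] g) : Analytic g :=
  ⟨(memLp_congr_ae h).1 hf.memLp, fun n hn => by rw [← fourierCoeff_congr_ae h, hf.coeff n hn]⟩

theorem Analytic.integrable {f : T → ℂ} (hf : Analytic f) : Integrable f m :=
  hf.memLp.integrable one_le_two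

theorem Analytic.add {f g : T → ℂ} (hf : Analytic f) (hg : Analytic g) :
    Analytic (fun t => f t + g t) :=
  ⟨hf.memLp.add hg.memLp, fun n hn => by
    have := congrFun (fourierCoeff.add hf.integrable hg.integrable) n
    rw [Pi.add_apply, hf.coeff n hn, hg.coeff n hn, add_zero] at this
    exact this⟩

theorem Analytic.const_mul {f : T → ℂ} (hf : Analytic f) (c : ℂ) : Analytic (fun t => c * f t) :=
  ⟨hf.memLp.const_mul c, fun n hn => by rw [fourierCoeff.const_mul, hf.coeff n hn, mul_zero]⟩

theorem mem_hardy_iff {f : L 2} : f ∈ hardy 2 ↔ Analytic f :=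
  ⟨fun h => ⟨Lp.memLp f, h⟩, fun h => h.coeff⟩

theorem integral_fourier (n : ℤ) : ∫ t, fourier n t ∂m = if n = 0 then 1 else 0 := by
  have h := (orthonormal_iff_ite.1 (orthonormal_fourier (T := 1))) 0 n
  rw [L2.inner_def] at h
  simp only [eq_comm (a := n), ← h]
  refine integral_congr_ae ?_
  filter_upwards [coeFn_fourierLp (T := (1 : ℝ)) 2 0, coeFn_fourierLp (T := (1 : ℝ)) 2 n]
    with t h1 h2
  rw [h1, h2, RCLike.inner_apply, fourier_zero, map_one, mul_one]

theorem fourierCoeff_fourier_mul (f : T → ℂ) (k n : ℤ) :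
    fourierCoeff (fun t => fourier k t * f t) n = fourierCoeff f (n - k) := by
  rw [fourierCoeff, fourierCoeff]
  congr 1
  funext t
  rw [show -(n - k) = -n + k by ring, fourier_add, smul_eq_mul, smul_eq_mul, mul_assoc]

theorem analytic_fourier_mul {f : T → ℂ} (hf : Analytic f) (k : ℕ) :
    Analytic (fun t => fourier k t * f t) := by
  refine ⟨?_, fun n hn => ?_⟩
  · refine (memLp_congr_norm ?_ hf.memLp.1 (.of_forall fun t => ?_)).2 hf.memLp
    · exact (fourier (k : ℤ)).continuous.aestronglyMeasurable.mul hf.memLp.1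
    · rw [norm_mul, norm_fourier_apply, one_mul]
  · rw [fourierCoeff_fourier_mul]
    exact hf.coeff _ (by omega)

theorem analytic_const (c : ℂ) : Analytic (fun _ => c) := by
  refine ⟨memLp_const c, fun n hn => ?_⟩
  simp only [fourierCoeff, smul_eq_mul]
  rw [integral_mul_const, integral_fourier, if_neg (by omega), zero_mul]

theorem analytic_fourier (k : ℕ) : Analytic (fourier (k : ℤ)) := by
  simpa only [mul_one] using analytic_fourier_mul (analytic_const 1) k

/-- An integral pairing with analytic functions is determined by the monomials. -/
theorem Analytic.integral_mul_eq_zero {q g : T → ℂ} (hg : Analytic g) (hq : MemLp q 2 m)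
    (h : ∀ k : ℕ, ∫ t, q t * fourier k t ∂m = 0) : ∫ t, q t * g t ∂m = 0 := by
  have hq' : MemLp (fun t => conj (q t)) 2 m := hq.star
  have key : ∀ {g : T → ℂ} (hg : MemLp g 2 m),
      inner ℂ (hq'.toLp _) (hg.toLp _) = ∫ t, q t * g t ∂m := by
    intro g hg
    rw [L2.inner_def]
    refine integral_congr_ae ?_
    filter_upwards [hq'.coeFn_toLp, hg.coeFn_toLp] with t h1 h2
    rw [h1, h2, RCLike.inner_apply, Complex.conj_conj, mul_comm]
  -- Pair the $L^2$ Fourier series of `g` with $\bar q$ term by term: negative indices vanish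
  -- because `g` is analytic, the others by `h`.
  have hs := (hasSum_fourier_series_L2 (hg.memLp.toLp g)).mapL (innerSL ℂ (hq'.toLp _))
  have hz : (fun i : ℤ => innerSL ℂ (hq'.toLp _)
      (fourierCoeff (hg.memLp.toLp g) i • fourierLp (T := (1 : ℝ)) 2 i)) = fun _ => 0 := by
    funext i
    rw [map_smul, innerSL_apply_apply]
    rcases lt_or_ge i 0 with hi | hi
    · rw [fourierCoeff_congr_ae hg.memLp.coeFn_toLp, hg.coeff i hi, zero_smul]
    · lift i to ℕ using hi
      have := key (memLp_continuous (fourier (i : ℤ)))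
      rw [h] at this
      have h2 : fourierLp (T := (1 : ℝ)) 2 (i : ℤ)
          = (memLp_continuous (p := 2) (fourier (i : ℤ))).toLp _ := rfl
      rw [h2, this, smul_zero]
  rw [hz, innerSL_apply_apply, key] at hs
  exact hs.unique hasSum_zero

/-- Absorbing the exponential of index $-n>0$ into `f` leaves an analytic function, whose product
with each monomial has mean zero. No square integrability of the product is needed. -/
theorem Analytic.fourierCoeff_mul {f g : T → ℂ} (hf : Analytic f) (hg : Analytic g) {n : ℤ}
    (hn : n < 0) : fourierCoeff (fun t => f t * g t) n = 0 := by
  have h1 : fourierCoeff (fun t => f t * g t) n = ∫ t, (fourier (-n) t * f t) * g t ∂m := by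
    simp only [fourierCoeff, smul_eq_mul, mul_assoc]
  rw [h1]
  obtain ⟨k, hk⟩ : ∃ k : ℕ, -n = k := ⟨(-n).toNat, by omega⟩
  rw [hk]
  refine hg.integral_mul_eq_zero (analytic_fourier_mul hf k).memLp fun j => ?_
  have h2 := hf.coeff (n - j) (by omega)
  rw [← h2, fourierCoeff]
  congr 1
  funext t
  rw [show -(n - (j : ℤ)) = k + j by omega, fourier_add, smul_eq_mul]
  ring

theorem Analytic.mul {f g : T → ℂ} (hf : Analytic f) (hg : Analytic g)
    (h : MemLp (fun t => f t * g t) 2 m) : Analytic (fun t => f t * g t) :=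
  ⟨h, fun _ hn => hf.fourierCoeff_mul hg hn⟩

theorem Analytic.mul_of_top {f g : T → ℂ} (hf : Analytic f) (hg : Analytic g)
    (h : MemLp f ∞ m) : Analytic (fun t => f t * g t) :=
  hf.mul hg (hg.memLp.mul h)

/-! ### The Szegő kernel -/

theorem szego_apply (w : Complex.UnitDisc) (t : T) :
    szego w t = 1 / (1 - conj (w : ℂ) * pt t) := rfl

/-- The geometric series in recursive form; both the Fourier coefficients of the kernel and its
reproducing property are drawn from it. -/
theorem szego_eq (w : Complex.UnitDisc) (t : T) :
    szego w t = 1 + conj (w : ℂ) * (fourier 1 t * szego w t) := by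
  have h := one_sub_ne w.norm_lt_one (norm_pt t).le
  rw [szego_apply, ← pt_eq_fourier]
  field_simp
  ring

theorem integrable_fourier_mul {f : T → ℂ} (hf : Integrable f m) (n : ℤ) :
    Integrable (fun t => fourier n t * f t) m :=
  hf.fourier_smul n

theorem integrable_continuous (f : C(T, ℂ)) : Integrable f m :=
  memLp_one_iff_integrable.1 (memLp_continuous f)

theorem fourierCoeff_szego (w : Complex.UnitDisc) (n : ℤ) :
    fourierCoeff (szego w) n =
      (if n = 0 then 1 else 0) + conj (w : ℂ) * fourierCoeff (szego w) (n - 1) := by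
  have h1 : ⇑(szego w) = (fun _ => (1 : ℂ)) + fun t => conj (w : ℂ) * (fourier 1 t * szego w t) :=
    funext fun t => szego_eq w t
  conv_lhs => rw [h1]
  rw [fourierCoeff.add (integrable_const _)
    ((integrable_fourier_mul (integrable_continuous (szego w)) 1).const_mul _), Pi.add_apply,
    fourierCoeff.const_mul, fourierCoeff_fourier_mul]
  congr 1
  simp only [fourierCoeff, smul_eq_mul, mul_one, integral_fourier, neg_eq_zero]

theorem norm_fourierCoeff_le (f : C(T, ℂ)) (n : ℤ) : ‖fourierCoeff f n‖ ≤ ‖f‖ := by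
  have := norm_integral_le_of_norm_le_const (μ := m) (C := ‖f‖)
    (f := fun t => fourier (-n) t • f t) (.of_forall fun t => by
      rw [norm_smul, norm_fourier_apply, one_mul]; exact f.norm_coe_le_norm t)
  simpa [fourierCoeff] using this

theorem analytic_szego (w : Complex.UnitDisc) : Analytic (szego w) := by
  refine ⟨memLp_continuous _, fun n hn => ?_⟩
  -- For negative index the recursion never meets the constant term, so j iterations leave a factor
  -- $\bar w^j$ against a bounded coefficient.
  have h1 : ∀ j : ℕ,
      fourierCoeff (szego w) n = conj (w : ℂ) ^ j * fourierCoeff (szego w) (n - j) := by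
    intro j
    induction j with
    | zero => simp
    | succ j ih =>
      rw [ih, fourierCoeff_szego, if_neg (by omega)]
      push_cast
      rw [show n - (j + 1 : ℤ) = n - j - 1 by ring]
      ring
  have h2 : Tendsto (fun j : ℕ => ‖(w : ℂ)‖ ^ j * ‖szego w‖) atTop (𝓝 (0 * ‖szego w‖)) :=
    (tendsto_pow_atTop_nhds_zero_of_lt_one (norm_nonneg _) w.norm_lt_one).mul_const _
  rw [zero_mul] at h2
  rw [← norm_le_zero_iff]
  refine ge_of_tendsto' h2 fun j => ?_
  rw [h1 j, norm_mul, norm_pow, RCLike.norm_conj]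
  gcongr
  exact norm_fourierCoeff_le _ _

theorem fourierCoeff_szego_zero (w : Complex.UnitDisc) : fourierCoeff (szego w) 0 = 1 := by
  rw [fourierCoeff_szego, (analytic_szego w).coeff _ (by omega)]
  simp

theorem value_const (w : Complex.UnitDisc) (c : ℂ) : value w (fun _ => c) = c := by
  have h := fourierCoeff_szego_zero w
  have h1 : value w (fun _ => c) = c * conj (fourierCoeff (szego w) 0) := by
    rw [value, integral_const_mul, fourierCoeff, ← integral_conj]
    simp
  rw [h1, h, map_one, mul_one]

theorem value_congr {f g : T → ℂ} (h : f =ᵐ[m] g) (w : Complex.UnitDisc) :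
    value w f = value w g :=
  integral_congr_ae (h.mono fun t ht => by simp only [ht])

theorem memLp_mul_szego {f : T → ℂ} (hf : MemLp f 2 m) (w : Complex.UnitDisc) :
    MemLp (fun t => f t * conj (szego w t)) 2 m :=
  MemLp.mul (p := 2) (q := ∞) (r := 2) (memLp_continuous (star (szego w))) hf

/-- On the circle $ζ\,\overline{k_w}=ζ+w\,\overline{k_w}$, and $\int ζg\,dm=0$ for analytic g; so
each factor ζ contributes a factor w. -/
theorem Analytic.value_fourier_mul {f : T → ℂ} (hf : Analytic f) (w : Complex.UnitDisc) (k : ℕ) :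
    value w (fun t => fourier k t * f t) = (w : ℂ) ^ k * value w f := by
  induction k with
  | zero => simp
  | succ k ih =>
    have hk := analytic_fourier_mul hf k
    have h0 : ∀ t, fourier (k + 1 : ℕ) t * f t * conj (szego w t)
        = fourier 1 t * (fourier k t * f t) + w * (fourier k t * f t * conj (szego w t)) := by
      intro t
      have h1 : fourier 1 t * conj (fourier 1 t) = 1 := by
        rw [Complex.mul_conj, Complex.normSq_eq_norm_sq, norm_fourier_apply]; simp
      have h2 : conj (szego w t) = 1 + w * (conj (fourier 1 t) * conj (szego w t)) := by
        conv_lhs => rw [szego_eq]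
        simp only [map_add, map_mul, map_one, Complex.conj_conj]
      have h3 : fourier (k + 1 : ℕ) t = fourier (k : ℤ) t * fourier 1 t := by
        rw [← fourier_add]; norm_cast
      rw [h3]
      linear_combination (fourier 1 t * (fourier k t * f t)) * h2
        + (fourier k t * f t * w * conj (szego w t)) * h1
    have h3 : ∫ t, fourier 1 t * (fourier k t * f t) ∂m = 0 := by
      have := hk.coeff (-1) (by omega)
      simpa only [fourierCoeff, smul_eq_mul, neg_neg] using this
    rw [value]
    simp only [h0]
    rw [integral_add (integrable_fourier_mul hk.integrable 1)
      (((memLp_mul_szego hk.memLp w).integrable one_le_two).const_mul _), h3,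
      integral_const_mul, zero_add, pow_succ']
    rw [value] at ih
    rw [ih, mul_assoc]

theorem value_fourier (w : Complex.UnitDisc) (k : ℕ) : value w (fourier (k : ℤ)) = (w : ℂ) ^ k := by
  have := (analytic_const 1).value_fourier_mul w k
  simpa only [mul_one, value_const] using this

/-- The value at a point is multiplicative. -/
theorem Analytic.value_mul {f g : T → ℂ} (hf : Analytic f) (hg : Analytic g)
    (w : Complex.UnitDisc) : value w (fun t => f t * g t) = value w f * value w g := by
  have hk : MemLp (fun t => conj (szego w t)) 2 m := memLp_continuous (star (szego w))
  have h1 : MemLp (fun t => f t * conj (szego w t)) 2 m := memLp_mul_szego hf.memLp w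
  have h2 : MemLp (fun t => value w f * conj (szego w t)) 2 m := hk.const_mul _
  have hint : ∀ {q g : T → ℂ}, MemLp q 2 m → MemLp g 2 m → Integrable (fun t => q t * g t) m :=
    fun hq hg => memLp_one_iff_integrable.1 (hg.mul hq)
  have key : ∀ {g : T → ℂ}, MemLp g 2 m →
      ∫ t, (f t * conj (szego w t) - value w f * conj (szego w t)) * g t ∂m
        = value w (fun t => f t * g t) - value w f * value w g := by
    intro g hg
    simp only [sub_mul]
    rw [integral_sub (hint h1 hg) (hint h2 hg)]
    simp only [mul_assoc (value w f)]
    rw [integral_const_mul]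
    simp only [value, mul_assoc, mul_comm (conj _)]
  -- The function $(f-f(w))\overline{k_w}$ annihilates every monomial, hence every analytic `g`.
  have h3 := hg.integral_mul_eq_zero (h1.sub h2) fun k => by
    have h4 := key (memLp_continuous (fourier (k : ℤ)))
    have h5 := hf.value_fourier_mul w k
    simp only [mul_comm _ (f _)] at h5
    rw [h5, value_fourier, mul_comm, sub_self] at h4
    exact h4
  have h6 := key hg.memLp
  exact sub_eq_zero.1 (h6.symm.trans h3)

/-- An analytic function with analytic conjugate is constant. -/
theorem Analytic.ae_eq_const {f : T → ℂ} (hf : Analytic f) (hf' : Analytic fun t => conj (f t)) :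
    ∃ c : ℂ, f =ᵐ[m] fun _ => c := by
  refine ⟨fourierCoeff f 0, ?_⟩
  have h0 : ∀ n : ℤ, n ≠ 0 → fourierCoeff f n = 0 := by
    intro n hn
    rcases lt_or_gt_of_ne hn with h | h
    · exact hf.coeff n h
    · have h1 := hf'.coeff (-n) (by omega)
      rw [← map_eq_zero (starRingEnd ℂ), ← h1, fourierCoeff, fourierCoeff, ← integral_conj]
      congr 1
      funext t
      rw [smul_eq_mul, smul_eq_mul, map_mul, ← fourier_neg]
  have hs := hasSum_fourier_series_L2 (hf.memLp.toLp f)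
  have h1 := hs.unique (hasSum_single 0 fun n hn => by
    rw [fourierCoeff_congr_ae hf.memLp.coeFn_toLp, h0 n hn, zero_smul])
  have h2 := Lp.coeFn_smul (fourierCoeff f 0) (fourierLp (T := (1 : ℝ)) 2 0)
  rw [fourierCoeff_congr_ae hf.memLp.coeFn_toLp] at h1
  filter_upwards [hf.memLp.coeFn_toLp, h2, coeFn_fourierLp (T := (1 : ℝ)) 2 0] with t e1 e2 e3
  rw [← e1, h1, e2, Pi.smul_apply, e3]
  simp

/-- A finite measure on the circle is determined by its Fourier coefficients. -/
theorem measure_ext_of_fourier {μ ν : Measure T} [IsFiniteMeasure μ] [IsFiniteMeasure ν]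
    (h : ∀ n : ℤ, ∫ t, fourier n t ∂μ = ∫ t, fourier n t ∂ν) : μ = ν := by
  have hint : ∀ (μ : Measure T) [IsFiniteMeasure μ] (f : C(T, ℂ)), Integrable f μ := fun μ _ f =>
    .of_bound f.continuous.aestronglyMeasurable ‖f‖ (.of_forall f.norm_coe_le_norm)
  have hcont : ∀ (μ : Measure T) [IsFiniteMeasure μ],
      Continuous fun f : C(T, ℂ) => ∫ t, f t ∂μ := by
    intro μ _
    refine LipschitzWith.continuous (K := (μ univ).toNNReal) ?_
    refine LipschitzWith.of_dist_le_mul fun f g => ?_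
    rw [dist_eq_norm, dist_eq_norm, ← integral_sub (hint μ f) (hint μ g)]
    have := norm_integral_le_of_norm_le_const (μ := μ) (C := ‖f - g‖)
      (f := fun t => f t - g t) (.of_forall fun t => (f - g).norm_coe_le_norm t)
    rw [mul_comm]
    exact this
  have hall : ∀ f : C(T, ℂ), ∫ t, f t ∂μ = ∫ t, f t ∂ν := by
    have hcl : IsClosed {f : C(T, ℂ) | ∫ t, f t ∂μ = ∫ t, f t ∂ν} :=
      isClosed_eq (hcont μ) (hcont ν)
    have hspan : (Submodule.span ℂ (range (@fourier (1 : ℝ))) : Set C(T, ℂ))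
        ⊆ {f | ∫ t, f t ∂μ = ∫ t, f t ∂ν} := by
      intro f hf
      induction hf using Submodule.span_induction with
      | mem x hx => obtain ⟨n, rfl⟩ := hx; exact h n
      | zero => simp
      | add x y _ _ hx hy =>
        simp only [mem_ofPred_eq, ContinuousMap.add_apply] at hx hy ⊢
        rw [integral_add (hint μ x) (hint μ y), integral_add (hint ν x) (hint ν y), hx, hy]
      | smul a x _ hx =>
        simp only [mem_ofPred_eq, ContinuousMap.smul_apply] at hx ⊢
        rw [integral_smul, integral_smul, hx]
    intro f
    have hf : f ∈ (Submodule.span ℂ (range (@fourier (1 : ℝ)))).topologicalClosure := by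
      rw [span_fourier_closure_eq_top]; trivial
    exact closure_minimal hspan hcl hf
  refine ext_of_forall_integral_eq_of_IsFiniteMeasure fun f => ?_
  have h1 := hall ⟨fun t => (f t : ℂ), by fun_prop⟩
  simp only [ContinuousMap.coe_mk] at h1
  rw [integral_complex_ofReal, integral_complex_ofReal] at h1
  exact_mod_cast h1

/-! ### Composition with automorphisms -/

theorem fourier_eq_pow (k : ℕ) (t : T) : fourier (k : ℤ) t = pt t ^ k := by
  rw [fourier_apply, natCast_zsmul, AddCircle.toCircle_nsmul, Circle.coe_pow]

theorem value_zero (f : T → ℂ) : value 0 f = ∫ t, f t ∂m := by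
  simp [value, szego_apply]

theorem memLp_pt_onCircle (γ : DiskAut) (k : ℕ) {p : ℝ≥0∞} :
    MemLp (fun t => pt (onCircle γ t) ^ k) p m := by
  refine (memLp_top_of_bound ?_ 1 (.of_forall fun t => ?_)).mono_exponent le_top
  · have h : Continuous fun t : T => pt t ^ k :=
      (continuous_subtype_val.comp AddCircle.continuous_toCircle).pow k
    exact (h.measurable.comp (measurable_onCircle γ)).aestronglyMeasurable
  · rw [norm_pow, norm_pt, one_pow]

/-- The boundary map is the polynomial $c(a-ζ)$ times the Szegő kernel at a, and the mean, being the
value at 0, is multiplicative. -/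
theorem analytic_pt_onCircle (γ : DiskAut) :
    Analytic (fun t => pt (onCircle γ t)) ∧
      ∫ t, pt (onCircle γ t) ∂m = (onDisk γ 0 : ℂ) := by
  obtain ⟨c, a, h1, h2⟩ := γ.2
  have hp : Analytic fun t => (c : ℂ) * a + -(c : ℂ) * fourier 1 t :=
    (analytic_const _).add ((analytic_fourier 1).const_mul _)
  have heq : (fun t => pt (onCircle γ t))
      = fun t => ((c : ℂ) * a + -(c : ℂ) * fourier 1 t) * szego a t := by
    funext t
    change pt (γ.1.2 t) = _
    rw [h2, mobius, szego_apply, ← pt_eq_fourier]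
    ring
  have ha : Analytic fun t => pt (onCircle γ t) := by
    have := memLp_pt_onCircle γ 1 (p := 2)
    simp only [pow_one] at this
    rw [heq] at this ⊢
    exact hp.mul (analytic_szego a) this
  refine ⟨ha, ?_⟩
  have hb : (onDisk γ 0 : ℂ) = c * a := by
    change ((γ.1.1 0 : Complex.UnitDisc) : ℂ) = _
    rw [h1]; simp [mobius]
  have hv : value 0 (szego a) = 1 := by
    rw [← fourierCoeff_szego_zero a, value_zero, fourierCoeff]
    simp
  have hl : value 0 (fun t => (c : ℂ) * a + -(c : ℂ) * fourier 1 t) = c * a := by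
    rw [value_zero, integral_add (integrable_const _)
      ((integrable_continuous (fourier 1)).const_mul _), integral_const_mul (-(c : ℂ)),
      integral_fourier]
    simp
  rw [← value_zero, heq, hp.value_mul (analytic_szego a), hv, hl, hb, mul_one]

theorem analytic_pt_onCircle_pow (γ : DiskAut) (k : ℕ) :
    Analytic (fun t => pt (onCircle γ t) ^ k) ∧
      ∫ t, pt (onCircle γ t) ^ k ∂m = (onDisk γ 0 : ℂ) ^ k := by
  induction k with
  | zero => simpa using analytic_const 1
  | succ k ih =>
    obtain ⟨h1, h2⟩ := analytic_pt_onCircle γ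
    have h3 := memLp_pt_onCircle γ (k + 1) (p := 2)
    simp only [pow_succ] at h3 ⊢
    refine ⟨ih.1.mul h1 h3, ?_⟩
    rw [← value_zero, ih.1.value_mul h1, value_zero, value_zero, ih.2, h2]

/-- The Poisson kernel. -/
def poisson (b : Complex.UnitDisc) (t : T) : ℝ := 2 * (szego b t).re - 1

theorem poisson_nonneg (b : Complex.UnitDisc) (t : T) : 0 ≤ poisson b t := by
  set z : ℂ := conj (b : ℂ) * pt t with hz
  have hzn : ‖z‖ < 1 := by
    rw [hz, norm_mul, norm_pt, RCLike.norm_conj, mul_one]; exact b.norm_lt_one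
  have h1 : Complex.normSq z < 1 := by
    rw [Complex.normSq_eq_norm_sq]; nlinarith [norm_nonneg z]
  have hne : Complex.normSq (1 - z) ≠ 0 := by
    rw [Ne, Complex.normSq_eq_zero]; exact one_sub_ne b.norm_lt_one (norm_pt t).le
  have hpos : 0 < Complex.normSq (1 - z) := lt_of_le_of_ne (Complex.normSq_nonneg _) hne.symm
  have h2 : poisson b t = (1 - Complex.normSq z) / Complex.normSq (1 - z) := by
    rw [poisson, szego_apply, ← hz, one_div, Complex.inv_re, eq_div_iff hne, sub_mul, mul_assoc,
      div_mul_cancel₀ _ hne]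
    simp only [Complex.normSq_apply, Complex.sub_re, Complex.sub_im, Complex.one_re, Complex.one_im]
    ring
  rw [h2]
  exact div_nonneg (by linarith) hpos.le

theorem poisson_le (b : Complex.UnitDisc) (t : T) : poisson b t ≤ 2 * ‖szego b‖ := by
  have h1 := Complex.re_le_norm (szego b t)
  have h2 := (szego b).norm_coe_le_norm t
  rw [poisson]
  linarith

theorem continuous_poisson (b : Complex.UnitDisc) : Continuous (poisson b) := by
  have := (szego b).continuous
  unfold poisson
  fun_prop

theorem integral_withDensity_ofReal {p : T → ℝ} (hp : Measurable p) (h0 : ∀ t, 0 ≤ p t)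
    (g : T → ℂ) : ∫ t, g t ∂(m.withDensity fun t => ENNReal.ofReal (p t))
      = ∫ t, (p t : ℂ) * g t ∂m := by
  rw [integral_withDensity_eq_integral_toReal_smul₀ hp.ennreal_ofReal.aemeasurable
    (.of_forall fun _ => ENNReal.ofReal_lt_top)]
  refine integral_congr_ae (.of_forall fun t => ?_)
  simp only [ENNReal.toReal_ofReal (h0 t)]
  exact Complex.real_smul

/-- Write the Poisson kernel as $k_b+\overline{k_b}-1$: the second term reproduces the monomial at
b, the other two cancel. -/
theorem integral_poisson_mul_fourier (b : Complex.UnitDisc) (k : ℕ) :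
    ∫ t, (poisson b t : ℂ) * fourier k t ∂m = (b : ℂ) ^ k := by
  have h0 : ∀ t, (poisson b t : ℂ) * fourier k t
      = fourier k t * szego b t + fourier k t * conj (szego b t) - fourier k t := by
    intro t
    have : ((poisson b t : ℝ) : ℂ) = szego b t + conj (szego b t) - 1 := by
      rw [Complex.add_conj, poisson]; push_cast; ring
    rw [this]; ring
  simp only [h0]
  have i1 : Integrable (fun t => fourier k t * szego b t) m :=
    integrable_fourier_mul (integrable_continuous (szego b)) k
  have i2 : Integrable (fun t => fourier k t * conj (szego b t)) m :=
    integrable_fourier_mul (integrable_continuous (star (szego b))) k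
  have i3 : Integrable (fun t => (fourier (k : ℤ) t : ℂ)) m := integrable_continuous _
  have v2 : ∫ t, fourier k t * conj (szego b t) ∂m = (b : ℂ) ^ k := value_fourier b k
  have v1 : ∫ t, fourier k t * szego b t ∂m = if (k : ℤ) = 0 then 1 else 0 := by
    have : ∫ t, fourier k t * szego b t ∂m = fourierCoeff (szego b) (-k) := by
      simp only [fourierCoeff, smul_eq_mul, neg_neg]
    rw [this]
    split_ifs with hk
    · rw [hk, neg_zero, fourierCoeff_szego_zero]
    · exact (analytic_szego b).coeff _ (by omega)
  rw [integral_sub (f := fun t => fourier k t * szego b t + fourier k t * conj (szego b t))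
    (i1.add i2) i3, integral_add i1 i2, v1, v2, integral_fourier]
  ring

/-- The image of Lebesgue measure under an automorphism is harmonic measure. -/
theorem map_onCircle (γ : DiskAut) : m.map (onCircle γ) =
    m.withDensity fun t => ENNReal.ofReal (poisson (onDisk γ 0) t) := by
  set b := onDisk γ 0
  have hpm : Measurable (poisson b) := (continuous_poisson b).measurable
  have hint : Integrable (poisson b) m :=
    .of_bound hpm.aestronglyMeasurable (2 * ‖szego b‖) (.of_forall fun t => by
      rw [Real.norm_of_nonneg (poisson_nonneg b t)]; exact poisson_le b t)
  have : IsFiniteMeasure (m.withDensity fun t => ENNReal.ofReal (poisson b t)) :=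
    isFiniteMeasure_withDensity_ofReal hint.2
  have : IsFiniteMeasure (m.map (onCircle γ)) := inferInstance
  have hnat : ∀ k : ℕ, ∫ t, fourier (k : ℤ) t ∂(m.map (onCircle γ))
      = ∫ t, fourier (k : ℤ) t ∂(m.withDensity fun t => ENNReal.ofReal (poisson b t)) := by
    intro k
    rw [integral_withDensity_ofReal hpm (poisson_nonneg b), integral_poisson_mul_fourier,
      integral_map (measurable_onCircle γ).aemeasurable
        (fourier (k : ℤ)).continuous.aestronglyMeasurable, ← (analytic_pt_onCircle_pow γ k).2]
    simp only [fourier_eq_pow]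
  refine measure_ext_of_fourier fun n => ?_
  obtain ⟨k, rfl | rfl⟩ := n.eq_nat_or_neg
  · exact hnat k
  · simp only [fourier_neg, integral_conj, hnat]

theorem integral_onCircle (γ : DiskAut) {g : T → ℂ} (hg : AEStronglyMeasurable g m) :
    ∫ t, g (onCircle γ t) ∂m = ∫ t, (poisson (onDisk γ 0) t : ℂ) * g t ∂m := by
  rw [← integral_withDensity_ofReal (continuous_poisson _).measurable (poisson_nonneg _),
    ← map_onCircle, integral_map (measurable_onCircle γ).aemeasurable]
  exact hg.mono_ac (quasiMeasurePreserving_onCircle γ).absolutelyContinuous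

theorem memLp_onCircle (γ : DiskAut) {p : ℝ≥0∞} {f : T → ℂ} (hf : MemLp f p m) :
    MemLp (fun t => f (onCircle γ t)) p m := by
  have hle : m.map (onCircle γ) ≤ ENNReal.ofReal (2 * ‖szego (onDisk γ 0)‖) • m := by
    rw [map_onCircle, ← withDensity_const]
    exact withDensity_mono (.of_forall fun t => ENNReal.ofReal_le_ofReal (poisson_le _ t))
  have h1 : MemLp f p (m.map (onCircle γ)) := hf.of_measure_le_smul ENNReal.ofReal_ne_top hle
  exact h1.comp_of_map (measurable_onCircle γ).aemeasurable

/-- Analyticity is preserved by composition with an automorphism. -/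
theorem Analytic.comp_onCircle {f : T → ℂ} (hf : Analytic f) (γ : DiskAut) :
    Analytic (fun t => f (onCircle γ t)) := by
  refine ⟨memLp_onCircle γ hf.memLp, fun n hn => ?_⟩
  have hinv : ∀ t, onCircle γ⁻¹ (onCircle γ t) = t := onCircle_inv γ
  have hem : Measurable fun t => fourier (-n) (onCircle γ⁻¹ t) :=
    (fourier (-n)).continuous.measurable.comp (measurable_onCircle _)
  -- Changing variables turns the coefficient of $g∘γ$ into a pairing of g with a fixed bounded
  -- function, so monomials suffice.
  have key : ∀ {g : T → ℂ}, MemLp g 2 m → fourierCoeff (fun t => g (onCircle γ t)) n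
      = ∫ t, ((poisson (onDisk γ 0) t : ℂ) * fourier (-n) (onCircle γ⁻¹ t)) * g t ∂m := by
    intro g hg
    have := integral_onCircle γ (g := fun t => fourier (-n) (onCircle γ⁻¹ t) * g t)
      (hem.aestronglyMeasurable.mul hg.1)
    simp only [hinv, ← mul_assoc] at this
    exact this
  rw [key hf.memLp]
  refine hf.integral_mul_eq_zero ?_ fun k => ?_
  · refine (memLp_top_of_bound ?_ (2 * ‖szego (onDisk γ 0)‖)
      (.of_forall fun t => ?_)).mono_exponent le_top
    · exact ((Complex.measurable_ofReal.comp (continuous_poisson _).measurable).mul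
        hem).aestronglyMeasurable
    · rw [norm_mul, norm_fourier_apply, mul_one, Complex.norm_real,
        Real.norm_of_nonneg (poisson_nonneg _ t)]
      exact poisson_le _ t
  · rw [← key (memLp_continuous (fourier (k : ℤ)))]
    simp only [fourier_eq_pow]
    exact (analytic_pt_onCircle_pow γ k).1.coeff n hn

/-! ### Outer functions -/

theorem coeFn_mulOp (f : L ∞) (g : L 2) : mulOp f g =ᵐ[m] fun t => f t * g t :=
  ContinuousLinearMap.coeFn_holder (r := 2) (ContinuousLinearMap.mul ℂ ℂ) f g

theorem inner_fourierLp (f : L 2) (n : ℤ) :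
    inner ℂ (fourierLp (T := (1 : ℝ)) 2 n) f = fourierCoeff f n := by
  rw [← coe_fourierBasis, ← HilbertBasis.repr_apply_apply, fourierBasis_repr]

/-- A nonnegative integrable function whose Fourier coefficients of nonzero index vanish is
constant. -/
theorem ae_eq_const_of_fourier {p : T → ℝ} (hp : Measurable p) (h0 : ∀ t, 0 ≤ p t)
    (hi : Integrable p m) (h : ∀ k : ℕ, k ≠ 0 → ∫ t, (p t : ℂ) * fourier k t ∂m = 0) :
    ∀ᵐ t ∂m, p t = ∫ s, p s ∂m := by
  set c := ∫ s, p s ∂m with hc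
  have hc0 : 0 ≤ c := integral_nonneg h0
  have : IsFiniteMeasure (m.withDensity fun t => ENNReal.ofReal (p t)) :=
    isFiniteMeasure_withDensity_ofReal hi.2
  have : IsFiniteMeasure (m.withDensity fun _ => ENNReal.ofReal c) :=
    isFiniteMeasure_withDensity_ofReal (integrable_const c).2
  have hnat : ∀ k : ℕ, ∫ t, fourier (k : ℤ) t ∂(m.withDensity fun t => ENNReal.ofReal (p t))
      = ∫ t, fourier (k : ℤ) t ∂(m.withDensity fun _ => ENNReal.ofReal c) := by
    intro k
    rw [integral_withDensity_ofReal hp h0, integral_withDensity_ofReal measurable_const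
      fun _ => hc0, integral_const_mul, integral_fourier]
    rcases eq_or_ne k 0 with rfl | hk
    · simp [integral_complex_ofReal, hc]
    · rw [h k hk, if_neg (by omega), mul_zero]
  have heq : (m.withDensity fun t => ENNReal.ofReal (p t))
      = m.withDensity fun _ => ENNReal.ofReal c := by
    refine measure_ext_of_fourier fun n => ?_
    obtain ⟨k, rfl | rfl⟩ := n.eq_nat_or_neg
    · exact hnat k
    · simp only [fourier_neg, integral_conj, hnat]
  rw [withDensity_eq_iff hp.ennreal_ofReal.aemeasurable aemeasurable_const
    hi.lintegral_lt_top.ne] at heq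
  filter_upwards [heq] with t ht
  exact (ENNReal.ofReal_eq_ofReal_iff (h0 t) hc0).1 ht

/-- The functions whose Fourier coefficients of nonpositive index vanish form the orthogonal
complement of the monomials of nonpositive index. -/
theorem mem_orthogonal_fourier_iff (g : L 2) :
    g ∈ (Submodule.span ℂ (fourierLp (T := (1 : ℝ)) 2 '' Iic 0))ᗮ ↔
      ∀ n : ℤ, n ≤ 0 → fourierCoeff g n = 0 := by
  rw [Submodule.mem_orthogonal]
  constructor
  · intro h n hn
    rw [← inner_fourierLp]
    exact h _ (Submodule.subset_span ⟨n, hn, rfl⟩)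
  · intro h x hx
    induction hx using Submodule.span_induction with
    | mem x hx => obtain ⟨n, hn, rfl⟩ := hx; rw [inner_fourierLp]; exact h n hn
    | zero => simp
    | add x y _ _ hx hy => rw [inner_add_left, hx, hy, add_zero]
    | smul a x _ hx => rw [inner_smul_left, hx, mul_zero]

/-- The component `r` of a real weight `u` orthogonal to all `u z`, where `z` has Fourier
coefficients of positive index only. -/
theorem exists_szego_residual {u : T → ℂ} (hu0 : ∀ t, u t ≠ 0) (huc : ∀ t, conj (u t) = u t)
    (hu : MemLp u ∞ m) (hui : MemLp (fun t => (u t)⁻¹) ∞ m) :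
    ∃ r : L 2, Analytic (fun t => (u t)⁻¹ * r t) ∧ fourierCoeff (fun t => (u t)⁻¹ * r t) 0 = 1 ∧
      ∀ z : T → ℂ, MemLp z 2 m → (∀ n : ℤ, n ≤ 0 → fourierCoeff z n = 0) →
        ∫ t, r t * (u t * conj (z t)) ∂m = 0 := by
  obtain ⟨V, hV⟩ : ∃ V : L 2 →L[ℂ] L 2, ∀ g : L 2, V g =ᵐ[m] fun t => (u t)⁻¹ * g t := by
    refine ⟨mulOp (hui.toLp _), fun g => ?_⟩
    filter_upwards [coeFn_mulOp (hui.toLp _) g, hui.coeFn_toLp] with t e1 e2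
    rw [e1, e2]
  -- `S` is u times the space of $L^2$ functions with only positive frequencies; `r` will be the
  -- component of u orthogonal to it.
  obtain ⟨S, hScl, hS⟩ : ∃ S : Submodule ℂ (L 2), IsClosed (S : Set (L 2)) ∧
      ∀ g : L 2, g ∈ S ↔ ∀ n : ℤ, n ≤ 0 → fourierCoeff (V g) n = 0 :=
    ⟨_, (Submodule.isClosed_orthogonal _).preimage V.continuous,
      fun g => (Submodule.mem_comap (f := V.toLinearMap)).trans (mem_orthogonal_fourier_iff _)⟩
  have : CompleteSpace S := hScl.completeSpace_coe
  have hu2 : MemLp u 2 m := hu.mono_exponent le_top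
  obtain ⟨P, hPS, hr⟩ : ∃ P ∈ S, ∀ g ∈ S, inner ℂ g (hu2.toLp u - P) = 0 :=
    ⟨S.starProjection (hu2.toLp u), Submodule.starProjection_apply_mem _ _,
      (Submodule.mem_orthogonal _ _).1 (Submodule.sub_starProjection_mem_orthogonal _)⟩
  obtain ⟨r, hrdef⟩ : ∃ r : L 2, r = hu2.toLp u - P := ⟨_, rfl⟩
  rw [← hrdef] at hr
  have hFeq : (fun t => (u t)⁻¹ * r t) =ᵐ[m] fun t => 1 + -1 * V P t := by
    filter_upwards [Lp.coeFn_sub (hu2.toLp u) P, hu2.coeFn_toLp,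
      hV P] with t e1 e2 e3
    rw [hrdef, e1, e3, Pi.sub_apply, e2, mul_sub, inv_mul_cancel₀ (hu0 t)]
    ring
  have hVP : Analytic (V P) :=
    ⟨Lp.memLp _, fun n hn => (hS _).1 hPS n hn.le⟩
  have hF : Analytic (fun t => (u t)⁻¹ * r t) :=
    ((analytic_const 1).add (hVP.const_mul (-1))).congr hFeq.symm
  have hF1 : fourierCoeff (fun t => (u t)⁻¹ * r t) 0 = 1 := by
    rw [fourierCoeff_congr_ae hFeq]
    have := congrFun (fourierCoeff.add (integrable_const (1 : ℂ))
      (hVP.integrable.const_mul (-1))) 0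
    refine this.trans ?_
    have hP0 : fourierCoeff (V P) 0 = 0 := (hS _).1 hPS 0 le_rfl
    rw [Pi.add_apply, fourierCoeff.const_mul, hP0]
    simp [fourierCoeff]
  refine ⟨r, hF, hF1, ?_⟩
  intro z hz hz0
  have huz : MemLp (fun t => u t * z t) 2 m := hz.mul hu
  have hmem : huz.toLp _ ∈ S := by
    rw [hS]
    intro n hn
    rw [← hz0 n hn]
    refine congrFun (fourierCoeff_congr_ae ?_) n
    filter_upwards [hV (huz.toLp _), huz.coeFn_toLp] with t e1 e2
    rw [e1, e2, inv_mul_cancel_left₀ (hu0 t)]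
  rw [← hr _ hmem, L2.inner_def]
  refine integral_congr_ae ?_
  filter_upwards [huz.coeFn_toLp] with t e
  rw [e, RCLike.inner_apply, map_mul, huc]

/-- Szegő's theorem in its simplest case: a weight bounded above and below is the squared modulus
of an invertible analytic function. -/
theorem exists_outer {w : T → ℝ} (hw : Measurable w) {ε M : ℝ} (hε : 0 < ε) (h1 : ∀ t, ε ≤ w t)
    (h2 : ∀ t, w t ≤ M) :
    ∃ h h' : T → ℂ, (Analytic h ∧ MemLp h ∞ m) ∧ (Analytic h' ∧ MemLp h' ∞ m) ∧
      (∀ᵐ t ∂m, h t * h' t = 1) ∧ ∀ᵐ t ∂m, ‖h t‖ ^ 2 = w t := by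
  have hw0 : ∀ t, 0 < w t := fun t => hε.trans_le (h1 t)
  let u : T → ℂ := fun t => (√(w t) : ℝ)
  have hu0 : ∀ t, u t ≠ 0 := fun t => Complex.ofReal_ne_zero.2 (Real.sqrt_pos.2 (hw0 t)).ne'
  have hun : ∀ t, ‖u t‖ = √(w t) := fun t => by
    rw [Complex.norm_real, Real.norm_of_nonneg (Real.sqrt_nonneg _)]
  have huc : ∀ t, conj (u t) = u t := fun t => Complex.conj_ofReal _
  have hum : Measurable u := Complex.measurable_ofReal.comp hw.sqrt
  have hu : MemLp u ∞ m := memLp_top_of_bound hum.aestronglyMeasurable (√M)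
    (.of_forall fun t => by rw [hun]; exact Real.sqrt_le_sqrt (h2 t))
  have hui : MemLp (fun t => (u t)⁻¹) ∞ m := memLp_top_of_bound hum.inv.aestronglyMeasurable
    (√ε)⁻¹ (.of_forall fun t => by
      rw [norm_inv, hun]
      exact inv_anti₀ (Real.sqrt_pos.2 hε) (Real.sqrt_le_sqrt (h1 t)))
  obtain ⟨r, hF, hF1, horth⟩ := exists_szego_residual hu0 huc hu hui
  set F : T → ℂ := fun t => (u t)⁻¹ * r t
  -- `|r|` is constant
  have hrm : Measurable fun t => ‖r t‖ ^ 2 := (Lp.stronglyMeasurable r).measurable.norm.pow_const 2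
  have hconst := ae_eq_const_of_fourier hrm (fun t => by positivity)
    ((memLp_two_iff_integrable_sq_norm (Lp.memLp r).1).1 (Lp.memLp r)) (by
      intro k hk
      -- Testing against $ζ^kF$ with $F=r/u$ shows that $|r|^2$ has no Fourier coefficient of index
      -- $k\ne0$.
      have hz := horth (fun t => fourier k t * F t) (analytic_fourier_mul hF k).memLp
        (fun n hn => by
          rw [fourierCoeff_fourier_mul]
          exact hF.coeff _ (by omega))
      have h3 : ∫ t, conj (((‖r t‖ ^ 2 : ℝ) : ℂ) * fourier k t) ∂m = 0 := by
        rw [← hz]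
        congr 1
        funext t
        have := hu0 t
        simp only [F, map_mul, map_inv₀, huc, Complex.conj_ofReal]
        have h4 : r t * conj (r t) = ((‖r t‖ ^ 2 : ℝ) : ℂ) := by
          rw [Complex.mul_conj, Complex.normSq_eq_norm_sq]
        rw [← h4]
        field_simp
      rw [integral_conj] at h3
      simpa using h3)
  set c : ℝ := ∫ t, ‖r t‖ ^ 2 ∂m
  have hcpos : 0 < c := by
    refine lt_of_le_of_ne (integral_nonneg fun t => by positivity) fun h0 => ?_
    have : F =ᵐ[m] fun _ => 0 := by
      filter_upwards [hconst] with t ht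
      rw [← h0] at ht
      have : r t = 0 := by simpa using ht
      simp [F, this]
    rw [fourierCoeff_congr_ae this] at hF1
    simp [fourierCoeff] at hF1
  -- Orthogonality to $uζ^k$, $k>0$, is exactly analyticity of $u\bar r$. Since $|r|^2=c$, the
  -- functions $h=u\bar r/\sqrt c$ and $h'=r/(u\sqrt c)$ are inverse to each other and
  -- $|h|^2=u^2=w$.
  have hG : Analytic fun t => u t * conj (r t) := by
    refine ⟨(Lp.memLp r).star.mul hu, fun n hn => ?_⟩
    obtain ⟨k, hk⟩ : ∃ k : ℕ, -n = k := ⟨(-n).toNat, by omega⟩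
    have hz := horth (fourier k) (memLp_continuous _) (fun j hj => by
      simp only [fourierCoeff, smul_eq_mul, ← fourier_add]
      rw [integral_fourier, if_neg (by omega)])
    rw [← map_eq_zero (starRingEnd ℂ), ← hz, fourierCoeff, ← integral_conj]
    congr 1
    funext t
    simp only [hk, smul_eq_mul, map_mul, huc, Complex.conj_conj]
    ring
  have hsc : ((√c : ℝ) : ℂ) * (√c : ℝ) = c := by
    rw [← Complex.ofReal_mul, Real.mul_self_sqrt hcpos.le]
  have hsc0 : ((√c : ℝ) : ℂ) ≠ 0 := Complex.ofReal_ne_zero.2 (Real.sqrt_pos.2 hcpos).ne'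
  have hhn : ∀ᵐ t ∂m, ‖((√c : ℝ) : ℂ)⁻¹ * (u t * conj (r t))‖ ^ 2 = w t := by
    filter_upwards [hconst] with t ht
    rw [norm_mul, norm_mul, mul_pow, mul_pow, RCLike.norm_conj, ht, hun, Real.sq_sqrt (hw0 t).le,
      norm_inv, Complex.norm_real, Real.norm_of_nonneg (Real.sqrt_nonneg _), inv_pow,
      Real.sq_sqrt hcpos.le]
    field_simp
  have hmul : ∀ᵐ t ∂m, ((√c : ℝ) : ℂ)⁻¹ * (u t * conj (r t)) * (((√c : ℝ) : ℂ)⁻¹ * F t) = 1 := by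
    filter_upwards [hconst] with t ht
    have h4 : r t * conj (r t) = c := by
      rw [Complex.mul_conj, Complex.normSq_eq_norm_sq, ht]
    have := hu0 t
    simp only [F]
    field_simp
    rw [mul_comm, h4, ← hsc, sq]
  have hA := hG.const_mul (((√c : ℝ) : ℂ)⁻¹)
  have hA' := hF.const_mul (((√c : ℝ) : ℂ)⁻¹)
  refine ⟨_, _, ⟨hA, ?_⟩, ⟨hA', ?_⟩, hmul, hhn⟩
  · refine memLp_top_of_bound hA.memLp.1 (√M) ?_
    filter_upwards [hhn] with t ht
    exact Real.le_sqrt_of_sq_le (ht.le.trans (h2 t))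
  · refine memLp_top_of_bound hA'.memLp.1 (√(ε⁻¹)) ?_
    filter_upwards [hhn, hmul] with t ht ht'
    refine Real.le_sqrt_of_sq_le ?_
    have h5 := congrArg (fun z : ℂ => ‖z‖ ^ 2) ht'
    simp only [norm_mul _ (_ * F t), mul_pow, ht, norm_one, one_pow] at h5
    rw [eq_inv_of_mul_eq_one_right h5]
    exact inv_anti₀ hε (h1 t)

/-! ### Invariant weights -/

/-- A `Γ`-invariant weight, bounded above and away from zero. -/
structure Weight (Γ : Subgroup DiskAut) (w : T → ℝ) : Prop where
  measurable : Measurable w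
  lower : ∃ ε > 0, ∀ t, ε ≤ w t
  upper : ∃ M, ∀ t, w t ≤ M
  invariant : ∀ γ : Γ, (fun t => w (onCircle γ t)) =ᵐ[m] w

variable {Γ : Subgroup DiskAut}

theorem Weight.pos {w : T → ℝ} (hw : Weight Γ w) (t : T) : 0 < w t := by
  obtain ⟨ε, hε, h⟩ := hw.lower
  exact hε.trans_le (h t)

theorem Weight.integrable_mul {w : T → ℝ} (hw : Weight Γ w) {g : T → ℝ} (hg : Integrable g m) :
    Integrable (fun t => g t * w t) m := by
  obtain ⟨M, hM⟩ := hw.upper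
  refine hg.mul_bdd (c := M) hw.measurable.aestronglyMeasurable (.of_forall fun t => ?_)
  rw [Real.norm_of_nonneg (hw.pos t).le]
  exact hM t

/-- Lets a mixture of excess functionals be treated as the excess of a single weight. Positivity of
the total mass keeps the mixture away from zero. -/
theorem weight_sum {ι : Type*} (s : Finset ι) (c : ι → ℝ) (hc : ∀ i, 0 ≤ c i)
    (hpos : 0 < ∑ i ∈ s, c i) (w : ι → T → ℝ) (hw : ∀ i, Weight Γ (w i)) :
    Weight Γ (fun t => ∑ i ∈ s, c i * w i t) := by
  refine ⟨Finset.measurable_fun_sum s fun i _ => (hw i).measurable.const_mul _, ?_, ?_, fun γ => ?_⟩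
  · choose ε hε h using fun i => (hw i).lower
    refine ⟨∑ i ∈ s, c i * ε i, ?_, fun t => Finset.sum_le_sum fun i _ =>
      mul_le_mul_of_nonneg_left (h i t) (hc i)⟩
    obtain ⟨i, hi, hci⟩ := Finset.exists_lt_of_sum_lt (s := s) (f := fun _ => (0 : ℝ)) (g := c)
      (by simpa using hpos)
    exact Finset.sum_pos' (fun j _ => mul_nonneg (hc j) (hε j).le) ⟨i, hi, mul_pos hci (hε i)⟩
  · choose M h using fun i => (hw i).upper
    exact ⟨∑ i ∈ s, c i * M i, fun t => Finset.sum_le_sum fun i _ =>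
      mul_le_mul_of_nonneg_left (h i t) (hc i)⟩
  · have h : ∀ᵐ t ∂m, ∀ i ∈ s, w i (onCircle γ t) = w i t :=
      (ae_ball_iff s.countable_toSet).2 fun i _ => (hw i).invariant γ
    filter_upwards [h] with t ht
    exact Finset.sum_congr rfl fun i hi => by rw [ht i hi]

theorem onCircle_mul (γ δ : DiskAut) (t : T) :
    onCircle (γ * δ) t = onCircle γ (onCircle δ t) := rfl

/-- If an invertible bounded analytic function and its composition with an automorphism have the
same modulus, they differ by a unimodular constant. -/
theorem exists_circle_mul_of_norm_eq {h h' : T → ℂ} (ha : Analytic h) (hb : MemLp h ∞ m)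
    (ha' : Analytic h') (hb' : MemLp h' ∞ m) (hmul : ∀ᵐ t ∂m, h t * h' t = 1) (γ : DiskAut)
    (hn : ∀ᵐ t ∂m, ‖h (onCircle γ t)‖ = ‖h t‖) :
    ∃ c : Circle, ∀ᵐ t ∂m, h (onCircle γ t) = c * h t := by
  -- `h'` stands for 1/h, so this is $θ=h∘γ/h$ and the next function is 1/θ, which equals $\barθ$
  -- because $|θ|=1$.
  have hθ : Analytic fun t => h' t * h (onCircle γ t) :=
    ha'.mul_of_top (ha.comp_onCircle γ) hb'
  have hθ' : Analytic fun t => h t * h' (onCircle γ t) :=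
    ha.mul_of_top (ha'.comp_onCircle γ) hb
  have hunit : ∀ᵐ t ∂m, ‖h' t * h (onCircle γ t)‖ = 1 := by
    filter_upwards [hmul, hn] with t e1 e2
    rw [norm_mul, e2, ← norm_mul, mul_comm, e1, norm_one]
  have hconj : (fun t => h t * h' (onCircle γ t))
      =ᵐ[m] fun t => conj (h' t * h (onCircle γ t)) := by
    filter_upwards [hmul, (quasiMeasurePreserving_onCircle γ).ae hmul, hunit] with t e1 e2 e3
    have e4 : (h' t * h (onCircle γ t)) * conj (h' t * h (onCircle γ t)) = 1 := by
      rw [Complex.mul_conj, Complex.normSq_eq_norm_sq, e3]; simp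
    generalize conj (h' t * h (onCircle γ t)) = q at e4 ⊢
    linear_combination (-(h t * h' (onCircle γ t))) * e4
      + (q * h (onCircle γ t) * h' (onCircle γ t)) * e1 + q * e2
  obtain ⟨c, hc⟩ := hθ.ae_eq_const (hθ'.congr hconj)
  have hc1 : ‖c‖ = 1 := by
    obtain ⟨t, e1, e2⟩ := (hc.and hunit).exists
    rw [← e2]
    exact congrArg norm e1.symm
  refine ⟨⟨c, mem_sphere_zero_iff_norm.2 hc1⟩, ?_⟩
  filter_upwards [hc, hmul] with t e1 e2
  linear_combination h t * e1 - h (onCircle γ t) * e2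

/-- Automorphy factors that are constants form a character. -/
theorem exists_character {h : T → ℂ} (h0 : ∀ᵐ t ∂m, h t ≠ 0)
    (hc : ∀ γ : Γ, ∃ c : Circle, ∀ᵐ t ∂m, h (onCircle γ t) = c * h t) :
    ∃ σ : Γ →* Circle, ∀ γ : Γ, ∀ᵐ t ∂m, h (onCircle γ t) = σ γ * h t := by
  choose s hs using hc
  have hsmul : ∀ γ δ : Γ, s (γ * δ) = s γ * s δ := by
    intro γ δ
    obtain ⟨t, e1, e2, e3, e4⟩ := ((hs (γ * δ)).and (((quasiMeasurePreserving_onCircle δ).ae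
      (hs γ)).and ((hs δ).and h0))).exists
    apply Circle.coe_injective
    refine mul_right_cancel₀ e4 ?_
    rw [← e1, Subgroup.coe_mul, onCircle_mul, e2, e3, Circle.coe_mul, mul_assoc]
  exact ⟨MonoidHom.mk' s hsmul, hs⟩

/-- An outer function whose modulus is invariant is character automorphic. -/
theorem Weight.exists_outer {w : T → ℝ} (hw : Weight Γ w) :
    ∃ (σ : Γ →* Circle) (h h' : T → ℂ), (Analytic h ∧ MemLp h ∞ m) ∧ (Analytic h' ∧ MemLp h' ∞ m) ∧
      (∀ᵐ t ∂m, h t * h' t = 1) ∧ (∀ᵐ t ∂m, ‖h t‖ ^ 2 = w t) ∧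
      (∀ γ : Γ, ∀ᵐ t ∂m, h (onCircle γ t) = σ γ * h t) ∧
      ∀ γ : Γ, ∀ᵐ t ∂m, h' (onCircle γ t) * σ γ = h' t := by
  obtain ⟨ε, hε, h1⟩ := hw.lower
  obtain ⟨M, h2⟩ := hw.upper
  obtain ⟨h, h', ⟨ha, hb⟩, ⟨ha', hb'⟩, hmul, hn⟩ :=
    FuchsianHardy.exists_outer hw.measurable hε h1 h2
  obtain ⟨σ, hσ⟩ := exists_character (Γ := Γ)
    (hmul.mono fun t ht => left_ne_zero_of_mul_eq_one ht) fun γ => by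
      refine exists_circle_mul_of_norm_eq ha hb ha' hb' hmul γ ?_
      filter_upwards [hn, (quasiMeasurePreserving_onCircle γ).ae hn, hw.invariant γ]
        with t e1 e2 e3
      rw [← sq_eq_sq₀ (norm_nonneg _) (norm_nonneg _), e1, e2, e3]
  refine ⟨σ, h, h', ⟨ha, hb⟩, ⟨ha', hb'⟩, hmul, hn, hσ, fun γ => ?_⟩
  filter_upwards [hσ γ, hmul, (quasiMeasurePreserving_onCircle γ).ae hmul] with t e1 e2 e3
  generalize ((σ γ : Circle) : ℂ) = c at e1 ⊢
  linear_combination h' t * e3 - h' (onCircle γ t) * h' t * e1 - h' (onCircle γ t) * c * e2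

/-! ### Norms and projections in $L^2$ -/

theorem norm_sq_eq_integral (x : L 2) : ‖x‖ ^ 2 = ∫ t, ‖x t‖ ^ 2 ∂m := by
  have h := L2.inner_def (𝕜 := ℂ) x x
  rw [inner_self_eq_norm_sq_to_K] at h
  have h1 : ∀ t, inner ℂ (x t) (x t) = ((‖x t‖ ^ 2 : ℝ) : ℂ) := fun t => by
    rw [inner_self_eq_norm_sq_to_K]; norm_cast
  simp only [h1] at h
  rw [integral_complex_ofReal] at h
  apply Complex.ofReal_injective
  rw [← h]
  norm_cast

theorem memLp_coe {p q : ℝ≥0∞} (f : L p) (h : q ≤ p) : MemLp f q m :=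
  (Lp.memLp f).mono_exponent h

variable {n : ℕ} (z : Fin n → Complex.UnitDisc)

theorem norm_sub_starProjection_le {K : Submodule ℂ (L 2)} [K.HasOrthogonalProjection] (y : L 2)
    {v : L 2} (hv : v ∈ K) : ‖y - K.starProjection y‖ ≤ ‖y - v‖ := by
  rw [Submodule.starProjection_minimal]
  exact ciInf_le (f := fun x : K => ‖y - x‖) ⟨0, by rintro _ ⟨x, rfl⟩; positivity⟩ ⟨v, hv⟩

/-! ### The two estimates

The distance dominates the operator norms since multiplication by an element of the ideal maps
`H^2_σ` into `N_σ`. Conversely, a bound for the operator norms gives, through the outer function of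
an invariant weight, a weighted least squares bound; the minimax principle makes the approximant
independent of the weight, so that it is a uniform approximant. The argument works for every group
`Γ`: convergence type and the dimension of the defect space play no role in it. -/

theorem mulOp_mem_charHardyVanishing {σ : Γ →* Circle} {φ : L ∞}
    (hφ : φ ∈ charHardyVanishing ∞ Γ 1 z) {x : L 2} (hx : x ∈ charHardy 2 Γ σ) :
    mulOp φ x ∈ charHardyVanishing 2 Γ σ z := by
  have hφa : Analytic φ := ⟨memLp_coe φ le_top, hφ.1.1⟩
  have hxa : Analytic x := mem_hardy_iff.1 hx.1
  have he := coeFn_mulOp φ x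
  refine ⟨⟨mem_hardy_iff.2 ((hφa.mul_of_top hxa (Lp.memLp φ)).congr he.symm), fun γ => ?_⟩,
    fun j => ?_⟩
  · filter_upwards [he, (quasiMeasurePreserving_onCircle γ).ae he, hφ.1.2 γ, hx.2 γ]
      with t e1 e2 e3 e4
    rw [e1, e2, e3, e4]
    simp only [MonoidHom.one_apply, Circle.coe_one]
    ring
  · rw [value_congr he, hφa.value_mul hxa, hφ.2 j, zero_mul]

theorem norm_le_dist (f φ : L ∞) (hφ : φ ∈ charHardyVanishing ∞ Γ 1 z) (σ : Γ →* Circle) :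
    ‖(ContinuousLinearMap.id ℂ (L 2) - (charHardyVanishing 2 Γ σ z).starProjection) ∘L
      mulOp f ∘L (charHardy 2 Γ σ).starProjection‖ ≤ dist f φ := by
  refine ContinuousLinearMap.opNorm_le_bound _ dist_nonneg fun x => ?_
  set y := (charHardy 2 Γ σ).starProjection x with hy
  have hyH : y ∈ charHardy 2 Γ σ := Submodule.starProjection_apply_mem _ _
  change ‖mulOp f y - (charHardyVanishing 2 Γ σ z).starProjection (mulOp f y)‖ ≤ _
  refine (norm_sub_starProjection_le _ (mulOp_mem_charHardyVanishing z hφ hyH)).trans ?_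
  have h1 : mulOp f y - mulOp φ y = (ContinuousLinearMap.mul ℂ ℂ).holder 2 (f - φ) y := by
    change (ContinuousLinearMap.mul ℂ ℂ).holderL m ∞ 2 2 f y
      - (ContinuousLinearMap.mul ℂ ℂ).holderL m ∞ 2 2 φ y = _
    rw [← sub_apply, ← map_sub]
    rfl
  rw [h1, dist_eq_norm]
  refine (ContinuousLinearMap.norm_holder_apply_apply_le _ _ _).trans ?_
  have h2 : ‖ContinuousLinearMap.mul ℂ ℂ‖ ≤ 1 := ContinuousLinearMap.opNorm_mul_le ℂ ℂ
  have h3 : ‖y‖ ≤ ‖x‖ := Submodule.norm_starProjection_apply_le _ _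
  calc ‖ContinuousLinearMap.mul ℂ ℂ‖ * ‖f - φ‖ * ‖y‖ ≤ 1 * ‖f - φ‖ * ‖x‖ := by gcongr
    _ = ‖f - φ‖ * ‖x‖ := by rw [one_mul]

/-- The weighted least squares estimate furnished by an outer function. -/
theorem exists_weighted_approx {f : L ∞} {C : ℝ}
    (hC : ∀ σ : Γ →* Circle,
      ‖(ContinuousLinearMap.id ℂ (L 2) - (charHardyVanishing 2 Γ σ z).starProjection) ∘L
        mulOp f ∘L (charHardy 2 Γ σ).starProjection‖ ≤ C) {w : T → ℝ} (hw : Weight Γ w) :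
    ∃ φ ∈ charHardyVanishing 2 Γ 1 z,
      ∫ t, ‖f t - φ t‖ ^ 2 * w t ∂m ≤ C ^ 2 * ∫ t, w t ∂m := by
  obtain ⟨σ, h, h', ⟨ha, hb⟩, ⟨ha', hb'⟩, hmul, hn, hσ, hσ'⟩ := hw.exists_outer
  -- The test vector is the outer function itself: $\|h\|^2=\int w$, and division by h turns
  -- $\|fh-g\|^2$ into the weighted error of $g/h$.
  let x : L 2 := ha.memLp.toLp h
  have hxe : x =ᵐ[m] h := ha.memLp.coeFn_toLp
  have hx : x ∈ charHardy 2 Γ σ := by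
    refine ⟨mem_hardy_iff.2 (ha.congr hxe.symm), fun γ => ?_⟩
    filter_upwards [hxe, (quasiMeasurePreserving_onCircle γ).ae hxe, hσ γ] with t e1 e2 e3
    rw [e1, e2, e3]
  let g : L 2 := (charHardyVanishing 2 Γ σ z).starProjection (mulOp f x)
  have hg : g ∈ charHardyVanishing 2 Γ σ z := Submodule.starProjection_apply_mem _ _
  have hga : Analytic g := mem_hardy_iff.1 hg.1.1
  have hφa : Analytic fun t => h' t * g t := ha'.mul_of_top hga hb'
  let φ : L 2 := hφa.memLp.toLp _
  have hφe : φ =ᵐ[m] fun t => h' t * g t := hφa.memLp.coeFn_toLp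
  refine ⟨φ, ⟨⟨mem_hardy_iff.2 (hφa.congr hφe.symm), fun γ => ?_⟩, fun j => ?_⟩, ?_⟩
  · filter_upwards [hφe, (quasiMeasurePreserving_onCircle γ).ae hφe, hσ' γ, hg.1.2 γ]
      with t e1 e2 e3 e4
    rw [e1, e2, e4, ← mul_assoc, e3]
    simp
  · rw [value_congr hφe, ha'.value_mul hga, hg.2 j, mul_zero]
  · have h1 : ‖mulOp f x - g‖ ≤ C * ‖x‖ := by
      have := (((ContinuousLinearMap.id ℂ (L 2)
        - (charHardyVanishing 2 Γ σ z).starProjection) ∘L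
        mulOp f ∘L (charHardy 2 Γ σ).starProjection).le_opNorm x).trans
        (mul_le_mul_of_nonneg_right (hC σ) (norm_nonneg x))
      rwa [ContinuousLinearMap.comp_apply, ContinuousLinearMap.comp_apply,
        Submodule.starProjection_eq_self_iff.2 hx] at this
    have h2 : ‖mulOp f x - g‖ ^ 2 = ∫ t, ‖f t - φ t‖ ^ 2 * w t ∂m := by
      rw [norm_sq_eq_integral]
      refine integral_congr_ae ?_
      filter_upwards [Lp.coeFn_sub (mulOp f x) g, coeFn_mulOp f x, hxe, hφe, hn, hmul]
        with t e1 e2 e3 e4 e5 e6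
      rw [e1, Pi.sub_apply, e2, e3, ← e5, ← mul_pow, ← norm_mul, e4]
      congr 2
      linear_combination g t * e6
    have h3 : ‖x‖ ^ 2 = ∫ t, w t ∂m := by
      rw [norm_sq_eq_integral]
      refine integral_congr_ae ?_
      filter_upwards [hxe, hn] with t e1 e2
      rw [e1, e2]
    rw [← h2, ← h3, ← mul_pow]
    exact pow_le_pow_left₀ (norm_nonneg _) h1 2

/-- The excess of the weighted distance of `f` and `φ` over the constant `C`. -/
def excess (f : L ∞) (C : ℝ) (w : T → ℝ) (φ : L 2) : ℝ :=
  ∫ t, (‖f t - φ t‖ ^ 2 - C ^ 2) * w t ∂m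

theorem integrable_norm_sub_sq (f : L ∞) (φ : L 2) :
    Integrable (fun t => ‖f t - φ t‖ ^ 2) m := by
  have h : MemLp (fun t => f t - φ t) 2 m := (memLp_coe f le_top).sub (Lp.memLp φ)
  exact (memLp_two_iff_integrable_sq_norm h.1).1 h

theorem Weight.excess_eq {w : T → ℝ} (hw : Weight Γ w) (f : L ∞) (C : ℝ) (φ : L 2) :
    excess f C w φ = ∫ t, ‖f t - φ t‖ ^ 2 * w t ∂m - C ^ 2 * ∫ t, w t ∂m := by
  have h1 := hw.integrable_mul (integrable_norm_sub_sq f φ)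
  have h2 := hw.integrable_mul (integrable_const (C ^ 2))
  simp only [excess, sub_mul]
  rw [integral_sub h1 h2, integral_const_mul]

/-- Multiplication by $\sqrt w$ exhibits the excess as the squared norm of an affine map minus a
constant; continuity and convexity follow. -/
theorem Weight.exists_excess_eq_norm {w : T → ℝ} (hw : Weight Γ w) (f : L ∞) (C : ℝ) :
    ∃ (A : L 2 →L[ℂ] L 2) (y : L 2) (c : ℝ), ∀ φ, excess f C w φ = ‖A φ - y‖ ^ 2 - c := by
  obtain ⟨M, hM⟩ := hw.upper
  let u : T → ℂ := fun t => (√(w t) : ℝ)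
  have hun : ∀ t, ‖u t‖ = √(w t) := fun t => by
    rw [Complex.norm_real, Real.norm_of_nonneg (Real.sqrt_nonneg _)]
  have hu : MemLp u ∞ m := memLp_top_of_bound
    (Complex.measurable_ofReal.comp hw.measurable.sqrt).aestronglyMeasurable (√M)
    (.of_forall fun t => by rw [hun]; exact Real.sqrt_le_sqrt (hM t))
  have hf2 : MemLp f 2 m := memLp_coe f le_top
  refine ⟨mulOp (hu.toLp u), mulOp (hu.toLp u) (hf2.toLp f), C ^ 2 * ∫ t, w t ∂m, fun φ => ?_⟩
  rw [hw.excess_eq, ← map_sub, norm_sq_eq_integral]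
  congr 1
  refine integral_congr_ae ?_
  filter_upwards [coeFn_mulOp (hu.toLp u) (φ - hf2.toLp f), hu.coeFn_toLp, hf2.coeFn_toLp,
    Lp.coeFn_sub φ (hf2.toLp f)] with t e1 e2 e3 e4
  rw [e1, e2, e4, Pi.sub_apply, e3, norm_mul, mul_pow, hun, Real.sq_sqrt (hw.pos t).le, mul_comm,
    norm_sub_rev]

theorem Weight.continuous_excess {w : T → ℝ} (hw : Weight Γ w) (f : L ∞) (C : ℝ) :
    Continuous (excess f C w) := by
  obtain ⟨A, y, c, h⟩ := hw.exists_excess_eq_norm f C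
  rw [funext h]
  exact (((A.continuous.sub continuous_const).norm).pow 2).sub continuous_const

theorem Weight.convexOn_excess {w : T → ℝ} (hw : Weight Γ w) (f : L ∞) (C : ℝ) :
    ConvexOn ℝ univ (excess f C w) := by
  obtain ⟨A, y, c, h⟩ := hw.exists_excess_eq_norm f C
  refine ⟨convex_univ, fun φ _ ψ _ a b ha hb hab => ?_⟩
  rw [h, h, h, smul_eq_mul, smul_eq_mul]
  have h1 : A (a • φ + b • ψ) - y = a • (A φ - y) + b • (A ψ - y) := by
    have h2 : y = a • y + b • y := by rw [← add_smul, hab, one_smul]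
    conv_lhs => rw [h2]
    rw [map_add, A.map_smul_of_tower, A.map_smul_of_tower, smul_sub, smul_sub]
    abel
  have h3 : ‖A (a • φ + b • ψ) - y‖ ≤ a * ‖A φ - y‖ + b * ‖A ψ - y‖ := by
    rw [h1]
    refine (norm_add_le _ _).trans_eq ?_
    rw [norm_smul, norm_smul, Real.norm_of_nonneg ha, Real.norm_of_nonneg hb]
  have h4 := pow_le_pow_left₀ (norm_nonneg _) h3 2
  obtain rfl : b = 1 - a := by linarith
  -- For p, q the two norms, $ap^2+bq^2-(ap+bq)^2=ab(p-q)^2$.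
  nlinarith [mul_nonneg (mul_nonneg ha hb) (sq_nonneg (‖A φ - y‖ - ‖A ψ - y‖))]

theorem weight_one : Weight Γ (fun _ => 1) :=
  ⟨measurable_const, ⟨1, one_pos, fun _ => le_rfl⟩, ⟨1, fun _ => le_rfl⟩, fun _ => .rfl⟩

/-- The constant weight supplies the bounded sublevel sets required by the minimax principle. -/
theorem isBounded_excess_one_le (f : L ∞) (C R : ℝ) :
    Bornology.IsBounded {φ | excess f C (fun _ => 1) φ ≤ R} := by
  have hf2 : MemLp f 2 m := memLp_coe f le_top
  refine (Metric.isBounded_closedBall (x := hf2.toLp f) (r := √(R + C ^ 2))).subset fun φ hφ => ?_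
  rw [Metric.mem_closedBall, dist_eq_norm]
  refine Real.le_sqrt_of_sq_le ?_
  have h1 : ‖φ - hf2.toLp f‖ ^ 2 = ∫ t, ‖f t - φ t‖ ^ 2 ∂m := by
    rw [norm_sq_eq_integral]
    refine integral_congr_ae ?_
    filter_upwards [hf2.coeFn_toLp, Lp.coeFn_sub φ (hf2.toLp f)] with t e1 e2
    rw [e2, Pi.sub_apply, e1, norm_sub_rev]
  have h2 : excess f C (fun _ => 1) φ ≤ R := hφ
  rw [(weight_one (Γ := ⊥)).excess_eq] at h2
  simp only [mul_one, integral_const, probReal_univ, smul_eq_mul] at h2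
  linarith

/-- If the weighted distance of two invariant functions is at most `C` for every invariant weight,
then so is their uniform distance. -/
theorem norm_sub_le_of_excess_nonpos {f : L ∞} (hf : f ∈ charL ∞ Γ 1) {φ : L 2}
    (hφ : φ ∈ charL 2 Γ 1) {C : ℝ} (hC : 0 ≤ C) (h : ∀ w, Weight Γ w → excess f C w φ ≤ 0) :
    ∀ᵐ t ∂m, ‖f t - φ t‖ ≤ C := by
  let E : Set T := {t | C < ‖f t - φ t‖}
  have hE : MeasurableSet E := measurableSet_lt measurable_const
    ((Lp.stronglyMeasurable f).measurable.sub (Lp.stronglyMeasurable φ).measurable).norm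
  have hEinv : ∀ γ : Γ, ∀ᵐ t ∂m, (onCircle γ t ∈ E ↔ t ∈ E) := by
    intro γ
    filter_upwards [hf γ, hφ γ] with t e1 e2
    change C < ‖f (onCircle γ t) - φ (onCircle γ t)‖ ↔ C < ‖f t - φ t‖
    rw [e1, e2]
    simp
  let D : T → ℝ := fun t => ‖f t - φ t‖ ^ 2 - C ^ 2
  have hD : Integrable D m := (integrable_norm_sub_sq f φ).sub (integrable_const _)
  have hDE : ∀ t ∈ E, 0 < D t := fun t ht => by
    have : C < ‖f t - φ t‖ := ht
    simp only [D]
    nlinarith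
  -- The indicator of `E` is invariant but not bounded below; adding δ makes it a weight, and δ
  -- tends to 0 afterwards.
  have hw : ∀ δ : ℝ, 0 < δ → Weight Γ (fun t => E.indicator 1 t + δ) := by
    intro δ hδ
    have h01 : ∀ t, 0 ≤ E.indicator (1 : T → ℝ) t ∧ E.indicator (1 : T → ℝ) t ≤ 1 := fun t => by
      by_cases ht : t ∈ E <;> simp [ht]
    refine ⟨(measurable_one.indicator hE).add_const δ, ⟨δ, hδ, fun t => by linarith [(h01 t).1]⟩,
      ⟨1 + δ, fun t => by linarith [(h01 t).2]⟩, fun γ => ?_⟩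
    filter_upwards [hEinv γ] with t ht
    by_cases h : t ∈ E
    · simp [h, ht.2 h]
    · simp [h, mt ht.1 h]
  have hle : ∫ t, E.indicator D t ∂m ≤ 0 := by
    have h1 : ∀ δ : ℝ, 0 < δ → ∫ t, E.indicator D t ∂m + δ * ∫ t, D t ∂m ≤ 0 := by
      intro δ hδ
      refine le_of_eq_of_le ?_ (h _ (hw δ hδ))
      rw [← integral_const_mul, ← integral_add (hD.indicator hE) (hD.const_mul δ), excess]
      congr 1
      funext t
      by_cases ht : t ∈ E <;> simp [ht, D] <;> ring
    have h2 : Tendsto (fun δ : ℝ => ∫ t, E.indicator D t ∂m + δ * ∫ t, D t ∂m) (𝓝[>] 0)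
        (𝓝 (∫ t, E.indicator D t ∂m + 0 * ∫ t, D t ∂m)) :=
      (Continuous.tendsto (by fun_prop) 0).mono_left nhdsWithin_le_nhds
    rw [zero_mul, add_zero] at h2
    exact le_of_tendsto h2 (eventually_mem_nhdsWithin.mono h1)
  have hnn : ∀ t, 0 ≤ E.indicator D t := indicator_nonneg fun t ht => (hDE t ht).le
  have hz := (integral_eq_zero_iff_of_nonneg hnn (hD.indicator hE)).1
    (le_antisymm hle (integral_nonneg hnn))
  filter_upwards [hz] with t ht
  by_contra! hcon
  have h1 := hDE t hcon
  rw [indicator_of_mem (show t ∈ E from hcon)] at ht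
  exact h1.ne' ht

/-- Minimax over all invariant weights at once gives an $L^2$ approximant; the uniform bound then
places it in $L^\infty$, hence in the ideal. -/
theorem infDist_le_of_norm_le {f : L ∞} (hf : f ∈ charL ∞ Γ 1) {C : ℝ} (hC0 : 0 ≤ C)
    (hC : ∀ σ : Γ →* Circle,
      ‖(ContinuousLinearMap.id ℂ (L 2) - (charHardyVanishing 2 Γ σ z).starProjection) ∘L
        mulOp f ∘L (charHardy 2 Γ σ).starProjection‖ ≤ C) :
    Metric.infDist f (charHardyVanishing ∞ Γ 1 z : Set (L ∞)) ≤ C := by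
  have hScl : IsClosed (charHardyVanishing 2 Γ 1 z : Set (L 2)) :=
    (isClosed_hardy.inter (isClosed_charL Γ 1)).inter (isClosed_vanishing z)
  obtain ⟨φ, hφ, hle⟩ := exists_forall_nonpos_of_mixtures (ι := {w : T → ℝ // Weight Γ w})
    (S := (charHardyVanishing 2 Γ 1 z : Set (L 2)))
    ((charHardyVanishing 2 Γ 1 z).restrictScalars ℝ).convex hScl ⟨0, zero_mem _⟩
    (fun w => excess f C w) (fun w => w.2.convexOn_excess f C) (fun w => w.2.continuous_excess f C)
    ⟨fun _ => 1, weight_one⟩ (isBounded_excess_one_le f C) (by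
      intro s c hc hpos
      have hw := weight_sum s c hc hpos (fun w : {w : T → ℝ // Weight Γ w} => w.1) fun w => w.2
      obtain ⟨φ, hφ, hle⟩ := exists_weighted_approx z hC hw
      refine ⟨φ, hφ, ?_⟩
      have h1 : ∑ i ∈ s, c i * excess f C i φ = excess f C (fun t => ∑ i ∈ s, c i * i.1 t) φ := by
        simp only [excess, Finset.mul_sum, ← integral_const_mul]
        rw [← integral_finsetSum]
        · congr 1
          funext t
          exact Finset.sum_congr rfl fun i _ => by ring
        · exact fun i _ => (i.2.integrable_mul
            ((integrable_norm_sub_sq f φ).sub (integrable_const _))).const_mul _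
      rw [h1, hw.excess_eq]
      linarith)
  have hb := norm_sub_le_of_excess_nonpos hf hφ.1.2 hC0 fun w hw => hle ⟨w, hw⟩
  have hsub : MemLp (fun t => f t - φ t) ∞ m :=
    memLp_top_of_bound ((Lp.memLp f).1.sub (Lp.memLp φ).1) C hb
  have hφ' : MemLp φ ∞ m := by
    have := (Lp.memLp f).sub hsub
    refine (memLp_congr_ae (.of_forall fun t => ?_)).1 this
    simp
  have he := hφ'.coeFn_toLp
  have hmem : hφ'.toLp φ ∈ charHardyVanishing ∞ Γ 1 z := by
    refine ⟨⟨fun k hk => ?_, fun γ => ?_⟩, fun j => ?_⟩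
    · rw [fourierCoeff_congr_ae he]
      exact hφ.1.1 k hk
    · filter_upwards [he, (quasiMeasurePreserving_onCircle γ).ae he, hφ.1.2 γ] with t e1 e2 e3
      rw [e1, e2, e3]
    · rw [value_congr he]
      exact hφ.2 j
  refine (Metric.infDist_le_dist_of_mem hmem).trans ?_
  rw [dist_eq_norm]
  have h1 := Lp.norm_le_of_ae_bound (f := f - hφ'.toLp φ) hC0 (by
    filter_upwards [Lp.coeFn_sub f (hφ'.toLp φ), he, hb] with t e1 e2 e3
    rwa [e1, Pi.sub_apply, e2])
  simpa using h1

/-! ### The distance formula -/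

theorem isLUB_infDist {f : L ∞} (hf : f ∈ charL ∞ Γ 1) :
    IsLUB (range fun σ : Γ →* Circle =>
      ‖(ContinuousLinearMap.id ℂ (L 2) - (charHardyVanishing 2 Γ σ z).starProjection) ∘L
        mulOp f ∘L (charHardy 2 Γ σ).starProjection‖)
      (Metric.infDist f (charHardyVanishing ∞ Γ 1 z : Set (L ∞))) := by
  constructor
  · rintro _ ⟨σ, rfl⟩
    exact (Metric.le_infDist ⟨0, zero_mem _⟩).2 fun φ hφ => norm_le_dist z f φ hφ σ
  · intro C hC
    -- The trivial character shows that any upper bound C is nonnegative.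
    exact infDist_le_of_norm_le z hf ((norm_nonneg _).trans (hC ⟨1, rfl⟩)) fun σ => hC ⟨σ, rfl⟩

theorem charHardyVanishing_of_isEmpty (p : ℝ≥0∞) [Fact (1 ≤ p)] (σ : Γ →* Circle)
    (z : Fin 0 → Complex.UnitDisc) : charHardyVanishing p Γ σ z = charHardy p Γ σ :=
  inf_eq_left.2 fun _ _ j => j.elim0

end FuchsianHardy

end

theorem theorem5p1 (Γ : Subgroup FuchsianHardy.DiskAut) (hΓ : FuchsianHardy.Admissible Γ)
    (f : FuchsianHardy.L ∞) (hf : f ∈ FuchsianHardy.charL ∞ Γ 1) :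
    (∀ (n : ℕ) (z : Fin n → Complex.UnitDisc),
      IsLUB
        (Set.range fun σ : Γ →* Circle =>
          ‖(ContinuousLinearMap.id ℂ (FuchsianHardy.L 2) -
            (FuchsianHardy.charHardyVanishing 2 Γ σ z).starProjection) ∘L
            FuchsianHardy.mulOp f ∘L (FuchsianHardy.charHardy 2 Γ σ).starProjection‖)
        (Metric.infDist f (FuchsianHardy.charHardyVanishing ∞ Γ 1 z : Set (FuchsianHardy.L ∞)))) ∧
    IsLUB
      (Set.range fun σ : Γ →* Circle =>
        ‖(ContinuousLinearMap.id ℂ (FuchsianHardy.L 2) -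
            (FuchsianHardy.charHardy 2 Γ σ).starProjection) ∘L
          FuchsianHardy.mulOp f ∘L (FuchsianHardy.charHardy 2 Γ σ).starProjection‖)
      (Metric.infDist f (FuchsianHardy.charHardy ∞ Γ 1 : Set (FuchsianHardy.L ∞))) := by
  refine ⟨fun n z => FuchsianHardy.isLUB_infDist z hf, ?_⟩
  have h := FuchsianHardy.isLUB_infDist (n := 0) ![] hf
  simpa only [FuchsianHardy.charHardyVanishing_of_isEmpty] using h
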